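/- **Theorem.** Write $0$ for the type of natural numbers, $1$ for the type $0\to 0$, and let the finite types be generated from $0$ by $\rho\to\tau$ and by $\sigma^{*}$ (finite sequences of objects of type $\sigma$). Consider classical many-sorted predicate logic over the finite types, with equality $=_0$ of type $0$ as the only primitive equality (equality of higher types being defined from it, pointwise on functions, and by equal length and equal entries on sequences) and with a predicate $\mathrm{st}$ ("is standard") on every type. A formula is internal if $\mathrm{st}$ does not occur in it; $(\forall^{\mathrm{st}}x)\varphi$ and $(\exists^{\mathrm{st}}x)\varphi$ abbreviate $(\forall x)(\mathrm{st}(x)\to\varphi)$ and $(\exists x)(\mathrm{st}(x)\wedge\varphi)$. Let $\mathsf{RCA}_0^{\Lambda}=\mathsf{P}_0+\mathsf{QF\text{-}AC}^{1,0}$, where $\mathsf{P}_0$ consists of the following. 1. $\mathsf{E\text{-}PRA}^{\omega*}$: the axioms of equality for $=_0$ and of successor; the combinators $\Pi,\Sigma$; the recursor $R_0$ of type $0$ ($R_0\,0\,y\,z=y$, $R_0\,(Sx)\,y\,z=z(R_0\,x\,y\,z)\,x$); the axiom of extensionality $x=_\rho y\to\varphi(x)=_\tau\varphi(y)$ for all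 $\rho,\tau$; quantifier-free induction; and the defining axioms for finite sequences (empty sequence, prepending an element, length, projection, tabulation $f,n\mapsto\langle f(0),\dots,f(n-1)\rangle$, recursion along sequences with values of type $0$, and "every sequence is empty or is obtained by prepending an element to a sequence"). 2. The axioms of standardness: $\mathrm{st}(x)\wedge x=y\to\mathrm{st}(y)$; $\mathrm{st}(t)$ for each closed term $t$; $\mathrm{st}(f)\wedge\mathrm{st}(x)\to\mathrm{st}(f(x))$. 3. $\mathsf{HAC}_{\mathsf{int}}$: $(\forall^{\mathrm{st}}x^{\rho})(\exists^{\mathrm{st}}y^{\tau})\varphi(x,y)\to(\exists^{\mathrm{st}}F^{\rho\to\tau^{*}})(\forall^{\mathrm{st}}x^{\rho})(\exists y^{\tau}\in F(x))\varphi(x,y)$, for internal $\varphi$, possibly with parameters. 4. Idealisation $\mathsf{I}$: $(\forall^{\mathrm{st}}x^{\sigma^{*}})(\exists y^{\tau})(\forall z^{\sigma}\in x)\varphi(z,y)\to(\exists y^{\tau})(\forall^{\mathrm{st}}z^{\sigma})\varphi(z,y)$, for internal $\varphi$, possibly with parameters. $\mathsf{QF\text{-}AC}^{1,0}$ is the schema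 $(\forall f^{1})(\exists n^{0})\varphi(f,n)\to(\exists F^{1\to 0})(\forall f^{1})\varphi(f,F(f))$ for quantifier-free internal $\varphi$, possibly with parameters. For $e,n$ of type $0$ and $A$ of type $1$, let $\Phi_e^{A}(n)=m$ denote the formula, formalised in $\mathsf{E\text{-}PRA}^{\omega*}$, stating that the $e$-th (register machine) program with oracle $A$ halts on input $n$ with output $m$. So $k\neq\Phi_e^A(n)$ means that $\Phi_e^A(n)=k$ does not hold; in particular it is true if $\Phi_e^A(n)$ is undefined. For $C,D$ of type $1$, write $C\approx_1 D$ for $(\forall^{\mathrm{st}}n^{0})\,C(n)=_0D(n)$. Let $\mathsf{UDNR}^{+}$ be the sentence $$(\exists^{\mathrm{st}}\Psi^{1\to1})\Big[(\forall^{\mathrm{st}}A^{1})(\forall e^{0})\big(\Psi(A)(e)\neq\Phi_e^{A}(e)\big)\wedge(\forall^{\mathrm{st}}C^{1},D^{1})\big(C\approx_1D\to\Psi(C)\approx_1\Psi(D)\big)\Big],$$ and let $\Pi^0_1\text{-}\mathsf{TRANS}$ be the sentence $$(\forall^{\mathrm{st}}f^{1})\big[(\forall^{\mathrm{st}}n^{0})\,f(n)=0\to(\forall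 m^{0})\,f(m)=0\big].$$ Then $\mathsf{RCA}_0^{\Lambda}$ proves $\mathsf{UDNR}^{+}\leftrightarrow\Pi^0_1\text{-}\mathsf{TRANS}$. -/

import Mathlib

/-!
# The nonstandard system `RCA₀^Λ` as a formal theory

Syntax (finite types with sequence types, terms, formulas with a standardness predicate),
classical many-sorted predicate logic, the axioms of `E-PRA^{ω*}`, `T*_st`, `HAC_int`, `I` and
`QF-AC^{1,0}`, oracle register machines as terms of the language, and the two principles.
-/

namespace NSRM

/-! ## Syntax -/

/-- Finite types: `0`, function types `σ → τ`, and types `σ*` of finite sequences. -/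
inductive Ty : Type
  | nat : Ty
  | arr (σ τ : Ty) : Ty
  | seq (σ : Ty) : Ty

local infixr:60 " ⇒ " => Ty.arr
local notation "ℕ₀" => Ty.nat

/-- The type `1`, i.e. `0 → 0`. -/
abbrev Ty.one : Ty := ℕ₀ ⇒ ℕ₀

/-- A typed family of variables `V`, extended by one new variable of type `σ`. -/
inductive Ext (V : Ty → Type) (σ : Ty) : Ty → Type
  | new : Ext V σ σ
  | old {τ : Ty} (x : V τ) : Ext V σ τ

/-- The empty family of variables. -/
abbrev NoVar : Ty → Type := fun _ => Empty

/-- The constants of the language. -/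
inductive Const : Ty → Type
  | zero : Const ℕ₀
  | succ : Const (ℕ₀ ⇒ ℕ₀)
  /-- the combinator `Π` -/
  | K (σ τ : Ty) : Const (σ ⇒ τ ⇒ σ)
  /-- the combinator `Σ` -/
  | S (ρ σ τ : Ty) : Const ((ρ ⇒ σ ⇒ τ) ⇒ (ρ ⇒ σ) ⇒ ρ ⇒ τ)
  /-- the recursor `R₀` of type `0` (primitive recursion in the sense of Kleene) -/
  | R : Const (ℕ₀ ⇒ ℕ₀ ⇒ (ℕ₀ ⇒ ℕ₀ ⇒ ℕ₀) ⇒ ℕ₀)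
  /-- the empty sequence -/
  | nil (σ : Ty) : Const (.seq σ)
  /-- prepending an element -/
  | cons (σ : Ty) : Const (σ ⇒ .seq σ ⇒ .seq σ)
  /-- the length `|x|` -/
  | len (σ : Ty) : Const (.seq σ ⇒ ℕ₀)
  /-- the projection `x, i ↦ (x)_i` -/
  | proj (σ : Ty) : Const (.seq σ ⇒ ℕ₀ ⇒ σ)
  /-- tabulation `f, n ↦ ⟨f 0, …, f (n - 1)⟩` -/
  | tab (σ : Ty) : Const ((ℕ₀ ⇒ σ) ⇒ ℕ₀ ⇒ .seq σ)
  /-- the sequence recursor with values of type `0` -/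
  | L (σ : Ty) : Const (.seq σ ⇒ ℕ₀ ⇒ (ℕ₀ ⇒ σ ⇒ ℕ₀) ⇒ ℕ₀)

/-- Terms of type `τ` with variables in `V`. -/
inductive Tm (V : Ty → Type) : Ty → Type
  | var {σ : Ty} (x : V σ) : Tm V σ
  | const {σ : Ty} (c : Const σ) : Tm V σ
  | app {σ τ : Ty} (t : Tm V (σ ⇒ τ)) (u : Tm V σ) : Tm V τ

local infixl:90 " ⬝ " => Tm.app

/-- Simultaneous substitution in terms. -/
def Tm.subst {V W : Ty → Type} (s : ∀ σ, V σ → Tm W σ) : {τ : Ty} → Tm V τ → Tm W τ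
  | _, .var x => s _ x
  | _, .const c => .const c
  | _, .app t u => .app (t.subst s) (u.subst s)

/-- Weakening by one variable. -/
def Tm.wk {V : Ty → Type} {ρ τ : Ty} (t : Tm V τ) : Tm (Ext V ρ) τ :=
  t.subst fun _ x => .var (.old x)

/-- The substitution that extends `s` by sending the newest variable to `t`. -/
def consSubst {V W : Ty → Type} {ρ : Ty} (t : Tm W ρ) (s : ∀ σ, V σ → Tm W σ) :
    ∀ σ, Ext V ρ σ → Tm W σ
  | _, .new => t
  | _, .old x => s _ x

/-- Lifting a substitution under a binder. -/
def liftSubst {V W : Ty → Type} (s : ∀ σ, V σ → Tm W σ) (ρ : Ty) :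
    ∀ σ, Ext V ρ σ → Tm (Ext W ρ) σ :=
  consSubst (.var .new) fun σ x => (s σ x).wk

/-- Formulas with free variables in `V`.  The only primitive equality is that of type `0`. -/
inductive Form : (Ty → Type) → Type 1
  | eq {V : Ty → Type} (t u : Tm V ℕ₀) : Form V
  | st {V : Ty → Type} {σ : Ty} (t : Tm V σ) : Form V
  | bot {V : Ty → Type} : Form V
  | imp {V : Ty → Type} (φ ψ : Form V) : Form V
  | all {V : Ty → Type} (σ : Ty) (φ : Form (Ext V σ)) : Form V

namespace Form

/-- Simultaneous (capture-avoiding) substitution in formulas. -/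
def subst : {V W : Ty → Type} → (∀ σ, V σ → Tm W σ) → Form V → Form W
  | _, _, s, .eq t u => .eq (t.subst s) (u.subst s)
  | _, _, s, .st t => .st (t.subst s)
  | _, _, _, .bot => .bot
  | _, _, s, .imp φ ψ => .imp (φ.subst s) (ψ.subst s)
  | _, _, s, .all σ φ => .all σ (φ.subst (liftSubst s σ))

variable {V : Ty → Type}

/-- Weakening by one variable. -/
def wk {ρ : Ty} (φ : Form V) : Form (Ext V ρ) := φ.subst fun _ x => .var (.old x)

/-- `φ(t)`, where `t` replaces the newest variable. -/
def inst {ρ : Ty} (φ : Form (Ext V ρ)) (t : Tm V ρ) : Form V := φ.subst (consSubst t fun _ x => .var x)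

def neg (φ : Form V) : Form V := imp φ bot
def or (φ ψ : Form V) : Form V := imp (neg φ) ψ
def and (φ ψ : Form V) : Form V := neg (imp φ (neg ψ))
def iff (φ ψ : Form V) : Form V := and (imp φ ψ) (imp ψ φ)
def ex (σ : Ty) (φ : Form (Ext V σ)) : Form V := neg (all σ (neg φ))

/-- `(∀ˢᵗ x^σ) φ(x)` -/
def allSt (σ : Ty) (φ : Form (Ext V σ)) : Form V := all σ (imp (st (.var .new)) φ)
/-- `(∃ˢᵗ x^σ) φ(x)` -/
def exSt (σ : Ty) (φ : Form (Ext V σ)) : Form V := ex σ (and (st (.var .new)) φ)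

/-- A formula is internal if it does not involve `st`. -/
def Internal : {V : Ty → Type} → Form V → Prop
  | _, .eq _ _ => True
  | _, .st _ => False
  | _, .bot => True
  | _, .imp φ ψ => φ.Internal ∧ ψ.Internal
  | _, .all _ φ => φ.Internal

/-- Quantifier-free (internal) formulas. -/
def QF : {V : Ty → Type} → Form V → Prop
  | _, .eq _ _ => True
  | _, .st _ => False
  | _, .bot => True
  | _, .imp φ ψ => φ.QF ∧ ψ.QF
  | _, .all _ _ => False

end Form

/-! ## Classical many-sorted predicate logic (natural deduction) -/

/-- `Prov T Γ φ`: the formula `φ` is derivable from the hypotheses `Γ` and the axioms `T`. -/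
inductive Prov (T : ∀ V : Ty → Type, Form V → Prop) :
    (V : Ty → Type) → List (Form V) → Form V → Prop
  | ax {V : Ty → Type} {Γ : List (Form V)} {φ : Form V} (h : T V φ) : Prov T V Γ φ
  | hyp {V : Ty → Type} {Γ : List (Form V)} {φ : Form V} (h : φ ∈ Γ) : Prov T V Γ φ
  | impI {V : Ty → Type} {Γ : List (Form V)} {φ ψ : Form V}
      (h : Prov T V (φ :: Γ) ψ) : Prov T V Γ (.imp φ ψ)
  | impE {V : Ty → Type} {Γ : List (Form V)} {φ ψ : Form V}
      (h₁ : Prov T V Γ (.imp φ ψ)) (h₂ : Prov T V Γ φ) : Prov T V Γ ψ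
  | raa {V : Ty → Type} {Γ : List (Form V)} {φ : Form V}
      (h : Prov T V (φ.neg :: Γ) .bot) : Prov T V Γ φ
  | allI {V : Ty → Type} {Γ : List (Form V)} {σ : Ty} {φ : Form (Ext V σ)}
      (h : Prov T (Ext V σ) (Γ.map Form.wk) φ) : Prov T V Γ (.all σ φ)
  | allE {V : Ty → Type} {Γ : List (Form V)} {σ : Ty} {φ : Form (Ext V σ)}
      (h : Prov T V Γ (.all σ φ)) (t : Tm V σ) : Prov T V Γ (φ.inst t)

/-! ## Terms: abstraction and primitive recursive functions -/

section Terms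

variable {V : Ty → Type}

/-- De Bruijn variables: `x0` is the newest variable, `x1` the one before it, etc. -/
abbrev x0 {σ : Ty} : Tm (Ext V σ) σ := .var .new
abbrev x1 {σ ρ : Ty} : Tm (Ext (Ext V σ) ρ) σ := .var (.old .new)
abbrev x2 {σ ρ₁ ρ₂ : Ty} : Tm (Ext (Ext (Ext V σ) ρ₁) ρ₂) σ := .var (.old (.old .new))
abbrev x3 {σ ρ₁ ρ₂ ρ₃ : Ty} : Tm (Ext (Ext (Ext (Ext V σ) ρ₁) ρ₂) ρ₃) σ :=
  .var (.old (.old (.old .new)))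
abbrev x4 {σ ρ₁ ρ₂ ρ₃ ρ₄ : Ty} : Tm (Ext (Ext (Ext (Ext (Ext V σ) ρ₁) ρ₂) ρ₃) ρ₄) σ :=
  .var (.old (.old (.old (.old .new))))

/-- Lambda abstraction of the newest variable, defined from the combinators. -/
def lam {σ : Ty} : {τ : Ty} → Tm (Ext V σ) τ → Tm V (σ ⇒ τ)
  | _, .var .new => .const (.S σ (σ ⇒ σ) σ) ⬝ .const (.K σ (σ ⇒ σ)) ⬝ .const (.K σ σ)
  | τ, .var (.old x) => .const (.K τ σ) ⬝ .var x
  | τ, .const c => .const (.K τ σ) ⬝ .const c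
  | τ, .app (σ := ρ) t u => .const (.S σ ρ τ) ⬝ lam t ⬝ lam u

def zeroT : Tm V ℕ₀ := .const .zero
def succT (t : Tm V ℕ₀) : Tm V ℕ₀ := .const .succ ⬝ t
def recT (n a : Tm V ℕ₀) (f : Tm V (ℕ₀ ⇒ ℕ₀ ⇒ ℕ₀)) : Tm V ℕ₀ := .const .R ⬝ n ⬝ a ⬝ f

/-- The zero functional `0^σ` of type `σ`. -/
def zeroOf : (σ : Ty) → Tm V σ
  | .nat => zeroT
  | .arr σ τ => .const (.K τ σ) ⬝ zeroOf τ
  | .seq σ => .const (.nil σ)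

def nilT (σ : Ty) : Tm V (.seq σ) := .const (.nil σ)
def consT {σ : Ty} (a : Tm V σ) (x : Tm V (.seq σ)) : Tm V (.seq σ) := .const (.cons σ) ⬝ a ⬝ x
def lenT {σ : Ty} (x : Tm V (.seq σ)) : Tm V ℕ₀ := .const (.len σ) ⬝ x
def projT {σ : Ty} (x : Tm V (.seq σ)) (i : Tm V ℕ₀) : Tm V σ := .const (.proj σ) ⬝ x ⬝ i
def tabT {σ : Ty} (f : Tm V (ℕ₀ ⇒ σ)) (n : Tm V ℕ₀) : Tm V (.seq σ) := .const (.tab σ) ⬝ f ⬝ n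
def lrecT {σ : Ty} (x : Tm V (.seq σ)) (a : Tm V ℕ₀) (f : Tm V (ℕ₀ ⇒ σ ⇒ ℕ₀)) : Tm V ℕ₀ :=
  .const (.L σ) ⬝ x ⬝ a ⬝ f

/-- Addition, by recursion on the second argument. -/
def addC : Tm V (ℕ₀ ⇒ ℕ₀ ⇒ ℕ₀) := lam (lam (recT x0 x1 (lam (lam (succT x1)))))
def addT (t u : Tm V ℕ₀) : Tm V ℕ₀ := addC ⬝ t ⬝ u

/-- Predecessor. -/
def predC : Tm V (ℕ₀ ⇒ ℕ₀) := lam (recT x0 zeroT (lam (lam x0)))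
def predT (t : Tm V ℕ₀) : Tm V ℕ₀ := predC ⬝ t

/-- Truncated subtraction. -/
def subC : Tm V (ℕ₀ ⇒ ℕ₀ ⇒ ℕ₀) := lam (lam (recT x0 x1 (lam (lam (predT x1)))))
def subT (t u : Tm V ℕ₀) : Tm V ℕ₀ := subC ⬝ t ⬝ u

/-- The distance `|t - u|`, which is `0` exactly if `t = u`. -/
def distT (t u : Tm V ℕ₀) : Tm V ℕ₀ := addT (subT t u) (subT u t)

/-- Case distinction: `a` if `c = 0`, and `b` otherwise. -/
def condC : Tm V (ℕ₀ ⇒ ℕ₀ ⇒ ℕ₀ ⇒ ℕ₀) := lam (lam (lam (recT x2 x1 (lam (lam x2)))))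
def condT (c a b : Tm V ℕ₀) : Tm V ℕ₀ := condC ⬝ c ⬝ a ⬝ b

/-- The triangular numbers `0 + 1 + ⋯ + n`. -/
def triC : Tm V (ℕ₀ ⇒ ℕ₀) := lam (recT x0 zeroT (lam (lam (succT (addT x1 x0)))))
def triT (t : Tm V ℕ₀) : Tm V ℕ₀ := triC ⬝ t

/-- Cantor's pairing function. -/
def pairC : Tm V (ℕ₀ ⇒ ℕ₀ ⇒ ℕ₀) := lam (lam (addT (triT (addT x1 x0)) x0))
def pairT (t u : Tm V ℕ₀) : Tm V ℕ₀ := pairC ⬝ t ⬝ u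

/-- The largest `w` such that the `w`-th triangular number is at most the argument. -/
def rootC : Tm V (ℕ₀ ⇒ ℕ₀) :=
  lam (recT x0 zeroT (lam (lam (condT (distT (succT x0) (triT (succT x1))) (succT x1) x1))))
def rootT (t : Tm V ℕ₀) : Tm V ℕ₀ := rootC ⬝ t

/-- The components of a number under Cantor's pairing function. -/
def sndC : Tm V (ℕ₀ ⇒ ℕ₀) := lam (subT x0 (triT (rootT x0)))
def sndT (t : Tm V ℕ₀) : Tm V ℕ₀ := sndC ⬝ t
def fstC : Tm V (ℕ₀ ⇒ ℕ₀) := lam (subT (rootT x0) (sndT x0))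
def fstT (t : Tm V ℕ₀) : Tm V ℕ₀ := fstC ⬝ t

/-- Numbers code eventually zero sequences: `l` codes the sequence with first entry `fst l`
whose tail is coded by `snd l`.  `getT j l` is the entry with index `j`. -/
def getC : Tm V (ℕ₀ ⇒ ℕ₀ ⇒ ℕ₀) := lam (lam (fstT (recT x1 x0 (lam (lam (sndT x1))))))
def getT (j l : Tm V ℕ₀) : Tm V ℕ₀ := getC ⬝ j ⬝ l

/-- `setT j v l` codes the sequence coded by `l` with entry `j` changed to `v`.  The entries with
indices `l + j, …, 1, 0` are prepended to `0` in this order; all later entries are zero. -/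
def setC : Tm V (ℕ₀ ⇒ ℕ₀ ⇒ ℕ₀ ⇒ ℕ₀) :=
  lam (lam (lam (recT (succT (addT x0 x2)) zeroT (lam (lam
    (pairT
      (condT (distT (subT (addT x2 x4) x0) x4) x3 (getT (subT (addT x2 x4) x0) x2))
      x1))))))
def setT (j v l : Tm V ℕ₀) : Tm V ℕ₀ := setC ⬝ j ⬝ v ⬝ l

/-! ### Oracle register machines

An unlimited register machine with oracle `A`: registers `R_0, R_1, …` hold numbers, a program is
a finite list of instructions, coded as an eventually zero sequence, and a configuration is a pair
of the program counter and the code of the registers.  An instruction is a pair `(o, x)`: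
* `o = 0`: halt (this includes the code `0`, i.e. running beyond the end of the program);
* `o = 1`: `R_x := 0`;
* `o = 2`: `R_x := R_x + 1`;
* `o = 3`, `x = (i, j)`: `R_j := R_i`;
* `o = 4`: `R_x := A(R_x)`;
* `o ≥ 5`, `x = (i, (j, q))`: if `R_i = R_j`, jump to instruction `q`. -/

/-- The instruction of the program `e` to be executed in the configuration `c`. -/
def instrT (e c : Tm V ℕ₀) : Tm V ℕ₀ := getT (fstT c) e

/-- The content of register `i` in the configuration `c`. -/
def regT (i c : Tm V ℕ₀) : Tm V ℕ₀ := getT i (sndT c)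

/-- Write `v` into register `i` and proceed to the next instruction. -/
def writeT (i v c : Tm V ℕ₀) : Tm V ℕ₀ := pairT (succT (fstT c)) (setT i v (sndT c))

/-- One step of the machine with program `e` and oracle `A`. -/
def stepT (A : Tm V Ty.one) (e c : Tm V ℕ₀) : Tm V ℕ₀ :=
  let o := fstT (instrT e c)
  let x := sndT (instrT e c)
  condT o c
    (condT (predT o) (writeT x zeroT c)
    (condT (predT (predT o)) (writeT x (succT (regT x c)) c)
    (condT (predT (predT (predT o))) (writeT (sndT x) (regT (fstT x) c) c)
    (condT (predT (predT (predT (predT o)))) (writeT x (A ⬝ regT x c) c)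
    (condT (distT (regT (fstT x) c) (regT (fstT (sndT x)) c))
      (pairT (sndT (sndT x)) (sndT c))
      (pairT (succT (fstT c)) (sndT c)))))))

/-- The configuration after `s` steps, started on the first instruction with `R_0 = n` and all
other registers zero. -/
def runT (A : Tm V Ty.one) (e n s : Tm V ℕ₀) : Tm V ℕ₀ :=
  recT s (pairT zeroT (pairT n zeroT)) (lam (lam (stepT A.wk.wk e.wk.wk x1)))

/-! ## Basic formulas -/

/-- Equality `t =_σ u`, defined from equality of type `0`. -/
def eqF : (σ : Ty) → {V : Ty → Type} → Tm V σ → Tm V σ → Form V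
  | .nat, _, t, u => .eq t u
  | .arr σ τ, _, t, u => .all σ (eqF τ (t.wk ⬝ x0) (u.wk ⬝ x0))
  | .seq σ, _, t, u =>
      .and (.eq (lenT t) (lenT u))
        (.all ℕ₀ (.imp (.eq (subT (succT x0) (lenT t.wk)) zeroT)
          (eqF σ (projT t.wk x0) (projT u.wk x0))))

/-- `t < u` -/
def ltF (t u : Tm V ℕ₀) : Form V := .eq (subT (succT t) u) zeroT

/-- `t ∈ x`, for a finite sequence `x`. -/
def memF {σ : Ty} (t : Tm V σ) (x : Tm V (.seq σ)) : Form V :=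
  .ex ℕ₀ (.and (ltF x0 (lenT x.wk)) (eqF σ t.wk (projT x.wk x0)))

/-- `t ≈₁ u` -/
def approx1 (t u : Tm V Ty.one) : Form V := .allSt ℕ₀ (.eq (t.wk ⬝ x0) (u.wk ⬝ x0))

/-- `Φ_{e,s}^A(n) = m`: the program `e` with oracle `A` and input `n` has halted after at most `s`
steps, with output `m` (in register `R_0`). -/
def computesInF (A : Tm V Ty.one) (e n s m : Tm V ℕ₀) : Form V :=
  .and (.eq (fstT (instrT e (runT A e n s))) zeroT) (.eq (regT zeroT (runT A e n s)) m)

/-- `Φ_e^A(n) = m` -/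
def computesF (A : Tm V Ty.one) (e n m : Tm V ℕ₀) : Form V :=
  .ex ℕ₀ (computesInF A.wk e.wk n.wk x0 m.wk)

end Terms

/-! ## Axioms -/

/-- The axioms of `E-PRA^{ω*}`: primitive recursive arithmetic in all finite types, with
extensionality and quantifier-free induction, extended with types for finite sequences. -/
inductive EPRA (V : Ty → Type) : Form V → Prop
  | eq_refl : EPRA V (.all ℕ₀ (.eq x0 x0))
  | eq_symm : EPRA V (.all ℕ₀ (.all ℕ₀ (.imp (.eq x1 x0) (.eq x0 x1))))
  | eq_trans : EPRA V (.all ℕ₀ (.all ℕ₀ (.all ℕ₀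
      (.imp (.eq x2 x1) (.imp (.eq x1 x0) (.eq x2 x0))))))
  | succ_ne_zero : EPRA V (.all ℕ₀ (.neg (.eq (succT x0) zeroT)))
  | succ_inj : EPRA V (.all ℕ₀ (.all ℕ₀ (.imp (.eq (succT x1) (succT x0)) (.eq x1 x0))))
  /-- the axiom of extensionality `(E)` -/
  | ext (ρ τ : Ty) : EPRA V (.all (ρ ⇒ τ) (.all ρ (.all ρ
      (.imp (eqF ρ x1 x0) (eqF τ (x2 ⬝ x1) (x2 ⬝ x0))))))
  | K (σ τ : Ty) : EPRA V (.all σ (.all τ (eqF σ (.const (.K σ τ) ⬝ x1 ⬝ x0) x1)))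
  | S (ρ σ τ : Ty) : EPRA V (.all (ρ ⇒ σ ⇒ τ) (.all (ρ ⇒ σ) (.all ρ
      (eqF τ (.const (.S ρ σ τ) ⬝ x2 ⬝ x1 ⬝ x0) (x2 ⬝ x0 ⬝ (x1 ⬝ x0))))))
  | rec_zero : EPRA V (.all ℕ₀ (.all (ℕ₀ ⇒ ℕ₀ ⇒ ℕ₀) (.eq (recT zeroT x1 x0) x1)))
  | rec_succ : EPRA V (.all ℕ₀ (.all ℕ₀ (.all (ℕ₀ ⇒ ℕ₀ ⇒ ℕ₀)
      (.eq (recT (succT x2) x1 x0) (x0 ⬝ recT x2 x1 x0 ⬝ x2)))))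
  /-- quantifier-free induction (with parameters) -/
  | qf_ind (φ : Form (Ext V ℕ₀)) (hφ : φ.QF) : EPRA V
      (.imp (φ.inst zeroT)
        (.imp (.all ℕ₀ (.imp φ (φ.subst (consSubst (succT x0) fun _ v => .var (.old v)))))
          (.all ℕ₀ φ)))
  /-- every finite sequence is empty or of the form `cons a x` -/
  | seq_cases (σ : Ty) : EPRA V (.all (.seq σ)
      (.or (eqF (.seq σ) x0 (nilT σ))
        (.ex σ (.ex (.seq σ) (eqF (.seq σ) x2 (consT x1 x0))))))
  | len_nil (σ : Ty) : EPRA V (.eq (lenT (nilT σ)) zeroT)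
  | len_cons (σ : Ty) : EPRA V (.all σ (.all (.seq σ)
      (.eq (lenT (consT x1 x0)) (succT (lenT x0)))))
  | proj_zero (σ : Ty) : EPRA V (.all σ (.all (.seq σ)
      (eqF σ (projT (consT x1 x0) zeroT) x1)))
  | proj_succ (σ : Ty) : EPRA V (.all σ (.all (.seq σ) (.all ℕ₀
      (eqF σ (projT (consT x2 x1) (succT x0)) (projT x1 x0)))))
  | proj_default (σ : Ty) : EPRA V (.all (.seq σ) (.all ℕ₀
      (.imp (.neg (ltF x0 (lenT x1))) (eqF σ (projT x1 x0) (zeroOf σ)))))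
  | len_tab (σ : Ty) : EPRA V (.all (ℕ₀ ⇒ σ) (.all ℕ₀ (.eq (lenT (tabT x1 x0)) x0)))
  | proj_tab (σ : Ty) : EPRA V (.all (ℕ₀ ⇒ σ) (.all ℕ₀ (.all ℕ₀
      (.imp (ltF x0 x1) (eqF σ (projT (tabT x2 x1) x0) (x2 ⬝ x0))))))
  | lrec_nil (σ : Ty) : EPRA V (.all ℕ₀ (.all (ℕ₀ ⇒ σ ⇒ ℕ₀)
      (.eq (lrecT (nilT σ) x1 x0) x1)))
  | lrec_cons (σ : Ty) : EPRA V (.all σ (.all (.seq σ) (.all ℕ₀ (.all (ℕ₀ ⇒ σ ⇒ ℕ₀)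
      (.eq (lrecT (consT x3 x2) x1 x0) (x0 ⬝ lrecT x2 x1 x0 ⬝ x3))))))

/-- The axioms `T*_st` on the standardness predicate. -/
inductive Tst (V : Ty → Type) : Form V → Prop
  | congr (σ : Ty) : Tst V (.all σ (.all σ (.imp (.and (.st x1) (eqF σ x1 x0)) (.st x0))))
  | closed {σ : Ty} (t : Tm NoVar σ) : Tst V (.st (t.subst fun _ x => x.elim))
  | app (σ τ : Ty) : Tst V (.all (σ ⇒ τ) (.all σ
      (.imp (.and (.st x1) (.st x0)) (.st (x1 ⬝ x0)))))

/-- `HAC_int`: `(∀ˢᵗ x^ρ)(∃ˢᵗ y^τ) φ(x, y) → (∃ˢᵗ F^{ρ → τ*})(∀ˢᵗ x^ρ)(∃ y^τ ∈ F(x)) φ(x, y)`,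
for internal `φ` (with parameters). -/
inductive HACint (V : Ty → Type) : Form V → Prop
  | mk (ρ τ : Ty) (φ : Form (Ext (Ext V ρ) τ)) (hφ : φ.Internal) : HACint V
      (.imp (.allSt ρ (.exSt τ φ))
        (.exSt (ρ ⇒ .seq τ) (.allSt ρ (.ex τ
          (.and (memF x0 (x2 ⬝ x1))
            (φ.subst (consSubst x0 (consSubst x1 fun _ v => .var (.old (.old (.old v)))))))))))

/-- Idealisation `I`:
`(∀ˢᵗ x^{σ*})(∃ y^τ)(∀ z^σ ∈ x) φ(z, y) → (∃ y^τ)(∀ˢᵗ z^σ) φ(z, y)`,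
for internal `φ` (with parameters; `y` precedes `z` in the list of variables of `φ`). -/
inductive Ideal (V : Ty → Type) : Form V → Prop
  | mk (σ τ : Ty) (φ : Form (Ext (Ext V τ) σ)) (hφ : φ.Internal) : Ideal V
      (.imp
        (.allSt (.seq σ) (.ex τ (.all σ (.imp (memF x0 x2)
          (φ.subst (consSubst x0 (consSubst x1 fun _ v => .var (.old (.old (.old v))))))))))
        (.ex τ (.allSt σ φ)))

/-- `QF-AC^{1,0}`: `(∀ f¹)(∃ n⁰) φ(f, n) → (∃ F^{1 → 0})(∀ f¹) φ(f, F(f))`,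
for quantifier-free `φ` (with parameters). -/
inductive QFAC (V : Ty → Type) : Form V → Prop
  | mk (φ : Form (Ext (Ext V Ty.one) ℕ₀)) (hφ : φ.QF) : QFAC V
      (.imp (.all Ty.one (.ex ℕ₀ φ))
        (.ex (Ty.one ⇒ ℕ₀) (.all Ty.one
          (φ.subst (consSubst (x1 ⬝ x0) (consSubst x0 fun _ v => .var (.old (.old v))))))))

/-- The system `P₀ = E-PRA^{ω*} + T*_st + HAC_int + I`. -/
def P0 (V : Ty → Type) (φ : Form V) : Prop :=
  EPRA V φ ∨ Tst V φ ∨ HACint V φ ∨ Ideal V φ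

/-- The system `RCA₀^Λ = P₀ + QF-AC^{1,0}`. -/
def RCA0Lambda (V : Ty → Type) (φ : Form V) : Prop := P0 V φ ∨ QFAC V φ

/-! ## The two principles -/

/-- `UDNR⁺`:
`(∃ˢᵗ Ψ^{1 → 1})[(∀ˢᵗ A¹)(∀ e⁰)(Ψ(A)(e) ≠ Φ_e^A(e)) ∧ (∀ˢᵗ C¹, D¹)(C ≈₁ D → Ψ(C) ≈₁ Ψ(D))]`. -/
def UDNRplus : Form NoVar :=
  .exSt (Ty.one ⇒ Ty.one) (.and
    (.allSt Ty.one (.all ℕ₀ (.neg (computesF x1 x0 x0 (x2 ⬝ x1 ⬝ x0)))))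
    (.allSt Ty.one (.allSt Ty.one (.imp (approx1 x1 x0) (approx1 (x2 ⬝ x1) (x2 ⬝ x0))))))

/-- `Π⁰₁-TRANS`: `(∀ˢᵗ f¹)[(∀ˢᵗ n⁰) f(n) = 0 → (∀ m⁰) f(m) = 0]`. -/
def Pi01TRANS : Form NoVar :=
  .allSt Ty.one (.imp
    (.allSt ℕ₀ (.eq (x1 ⬝ x0) zeroT))
    (.all ℕ₀ (.eq (x1 ⬝ x0) zeroT)))

end NSRM

namespace NSRM

local infixr:60 " ⇒ " => Ty.arr
local notation "ℕ₀" => Ty.nat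
local infixl:90 " ⬝ " => Tm.app

/-! ## Substitution calculus -/

section Substitution

variable {V W X : Ty → Type}

/-! The equivalence is proved in every model and then turned into a derivation by completeness. The
language is countable and derivability is closed under substitution, so a Henkin construction with
fresh variables as witnesses gives, for each underivable sentence, a term model refuting it.
Extensionality makes the defined equalities congruences, so terms can be identified along them, and
in the resulting `Model` equality of every type is identity. Models have only quantifier-free
induction, so the arithmetic, the pairing function and the machine runs are developed from that
alone.

From `UDNR⁺` to transfer (`IsUDNR.transfer`): let `f` be standard and zero on the standard numbers.
Let `e` be the program that looks for a positive `n` with `A(n) ≠ n` and outputs `A(n)`, let `I` be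
the identity, and let `k = Ψ(I)(e)`, a standard number. Put `D(n) = n` if `f(n) = 0` and `D(n) = k`
otherwise. Then `D` is standard and `D ≈₁ I`, so `Ψ(D)(e) = k`. If the search with oracle `D`
succeeded, it would output `k = Ψ(D)(e)`, which is forbidden. Hence `D(n) = n` for all positive `n`.
So `f(m) ≠ 0` with `m` positive forces `m = k`; but `k` is standard, where `f` vanishes (`search` is
the machine-level part).

From transfer to `UDNR⁺` (`Transfer.exists_isUDNR`): transfer says that each standard `f` has a
standard `n` such that `f(n) ≠ 0` if `f` is nonzero anywhere. This matrix is internal, so `HAC_int`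
yields a standard functional listing finitely many candidates, and checking them one by one finds a
nonzero value. Applied to the halting predicate this gives a stage `g(A, e)` by which `Φ_e^A(e)` has
halted if it halts at all, at first for standard `e`; a further transfer extends this to all `e`.
Then `Ψ(A)(e)` is the output plus one, or zero. Respecting `≈₁` costs nothing: by transfer, standard
functions that agree on the standard numbers are equal.

Neither direction uses idealisation or `QF-AC^{1,0}`. -/

theorem Tm.subst_subst (s : ∀ σ, V σ → Tm W σ) (s' : ∀ σ, W σ → Tm X σ) {τ : Ty} (t : Tm V τ) :
    (t.subst s).subst s' = t.subst fun σ x => (s σ x).subst s' := by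
  induction t with
  | var x => rfl
  | const c => rfl
  | app t u iht ihu => simp only [Tm.subst, iht, ihu]

@[simp] theorem Tm.subst_var {τ : Ty} (t : Tm V τ) : t.subst (fun _ x => .var x) = t := by
  induction t with
  | var x => rfl
  | const c => rfl
  | app t u iht ihu => simp only [Tm.subst, iht, ihu]

@[simp] theorem Tm.wk_subst_consSubst {ρ τ : Ty} (u : Tm W ρ) (s : ∀ σ, V σ → Tm W σ)
    (t : Tm V τ) : (t.wk (ρ := ρ)).subst (consSubst u s) = t.subst s :=
  Tm.subst_subst _ _ t

@[simp] theorem Tm.wk_subst_liftSubst {ρ τ : Ty} (s : ∀ σ, V σ → Tm W σ) (t : Tm V τ) :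
    (t.wk (ρ := ρ)).subst (liftSubst s ρ) = (t.subst s).wk := by
  simp only [Tm.wk, Tm.subst_subst]; rfl

theorem consSubst_comp {ρ : Ty} (t : Tm W ρ) (s : ∀ σ, V σ → Tm W σ) (s' : ∀ σ, W σ → Tm X σ) :
    (fun σ x => (consSubst t s σ x).subst s') =
      consSubst (t.subst s') fun σ x => (s σ x).subst s' := by
  funext σ x; cases x <;> rfl

theorem liftSubst_comp (s : ∀ σ, V σ → Tm W σ) (s' : ∀ σ, W σ → Tm X σ) (ρ : Ty) :
    (fun σ x => (liftSubst s ρ σ x).subst (liftSubst s' ρ)) =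
      liftSubst (fun σ x => (s σ x).subst s') ρ := by
  funext σ x
  cases x with
  | new => rfl
  | old x => exact Tm.wk_subst_liftSubst s' (s _ x)

theorem liftSubst_consSubst {ρ : Ty} (s : ∀ σ, V σ → Tm W σ) (t : Tm X ρ)
    (s' : ∀ σ, W σ → Tm X σ) :
    (fun σ x => (liftSubst s ρ σ x).subst (consSubst t s')) =
      consSubst t fun σ x => (s σ x).subst s' := by
  funext σ x
  cases x with
  | new => rfl
  | old x => exact Tm.wk_subst_consSubst t s' (s _ x)

theorem consSubst_new {ρ : Ty} :
    consSubst (.var .new) (fun _ x => .var (.old x)) = fun _ (x : Ext V ρ _) => Tm.var x := by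
  funext σ x; cases x <;> rfl

theorem liftSubst_var (ρ : Ty) :
    liftSubst (fun _ x => Tm.var x) ρ = fun _ (x : Ext V ρ _) => Tm.var x := consSubst_new

theorem Form.subst_subst (φ : Form V) : ∀ {W X : Ty → Type} (s : ∀ σ, V σ → Tm W σ)
    (s' : ∀ σ, W σ → Tm X σ), (φ.subst s).subst s' = φ.subst fun σ x => (s σ x).subst s' := by
  induction φ with
  | eq t u => intros; simp only [Form.subst, Tm.subst_subst]
  | st t => intros; simp only [Form.subst, Tm.subst_subst]
  | bot => intros; rfl
  | imp φ ψ ih₁ ih₂ => intros; simp only [Form.subst, ih₁, ih₂]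
  | all σ φ ih => intros; simp only [Form.subst, ih, liftSubst_comp]

@[simp] theorem Form.subst_var (φ : Form V) : φ.subst (fun _ x => .var x) = φ := by
  induction φ with
  | eq t u => simp only [Form.subst, Tm.subst_var]
  | st t => simp only [Form.subst, Tm.subst_var]
  | bot => rfl
  | imp φ ψ ih₁ ih₂ => simp only [Form.subst, ih₁, ih₂]
  | all σ φ ih => simp only [Form.subst, liftSubst_var, ih]

theorem Form.wk_subst_liftSubst {ρ : Ty} (s : ∀ σ, V σ → Tm W σ) (φ : Form V) :
    (φ.wk (ρ := ρ)).subst (liftSubst s ρ) = (φ.subst s).wk := by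
  simp only [Form.wk, Form.subst_subst]; rfl

theorem Form.inst_subst {ρ : Ty} (s : ∀ σ, V σ → Tm W σ) (φ : Form (Ext V ρ)) (t : Tm V ρ) :
    (φ.inst t).subst s = (φ.subst (liftSubst s ρ)).inst (t.subst s) := by
  simp only [Form.inst, Form.subst_subst, consSubst_comp, liftSubst_consSubst, Tm.subst_var,
    Tm.subst]

theorem Form.subst_liftSubst_inst {ρ : Ty} (s : ∀ σ, V σ → Tm W σ) (φ : Form (Ext V ρ))
    (t : Tm W ρ) : (φ.subst (liftSubst s ρ)).inst t = φ.subst (consSubst t s) := by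
  simp only [Form.inst, Form.subst_subst, liftSubst_consSubst, Tm.subst_var]

theorem Form.Internal.subst {φ : Form V} (h : φ.Internal) :
    ∀ {W : Ty → Type} (s : ∀ σ, V σ → Tm W σ), (φ.subst s).Internal := by
  induction φ with
  | eq t u => intros; trivial
  | st t => exact h.elim
  | bot => intros; trivial
  | imp φ ψ ih₁ ih₂ => exact fun s => ⟨ih₁ h.1 s, ih₂ h.2 s⟩
  | all σ φ ih => exact fun s => ih h _

theorem Form.QF.subst {φ : Form V} (h : φ.QF) :
    ∀ {W : Ty → Type} (s : ∀ σ, V σ → Tm W σ), (φ.subst s).QF := by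
  induction φ with
  | eq t u => intros; trivial
  | st t => exact h.elim
  | bot => intros; trivial
  | imp φ ψ ih₁ ih₂ => exact fun s => ⟨ih₁ h.1 s, ih₂ h.2 s⟩
  | all σ φ ih => exact h.elim

theorem eqF_subst (σ : Ty) : ∀ {V W : Ty → Type} (s : ∀ σ, V σ → Tm W σ) (t u : Tm V σ),
    (eqF σ t u).subst s = eqF σ (t.subst s) (u.subst s) := by
  induction σ with
  | nat => intros; rfl
  | arr σ τ _ ih =>
    intro V W s t u
    simp only [eqF, Form.subst, ih, Tm.subst, Tm.wk_subst_liftSubst]; rfl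
  | seq σ ih =>
    intro V W s t u
    simp only [eqF, Form.subst, Form.and, Form.neg, ih, lenT, projT, Tm.subst,
      Tm.wk_subst_liftSubst]
    congr 6
    simp only [subT, Tm.subst, Tm.wk_subst_liftSubst]; rfl

theorem zeroOf_subst (σ : Ty) (s : ∀ σ, V σ → Tm W σ) : (zeroOf σ).subst s = zeroOf σ := by
  induction σ with
  | nat => rfl
  | arr σ τ _ ih => simp only [zeroOf, Tm.subst, ih]
  | seq σ => rfl

theorem memF_subst {σ : Ty} (s : ∀ σ, V σ → Tm W σ) (t : Tm V σ) (x : Tm V (.seq σ)) :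
    (memF t x).subst s = memF (t.subst s) (x.subst s) := by
  simp only [memF, Form.ex, Form.and, Form.neg, Form.subst, eqF_subst, ltF, lenT, projT, Tm.subst,
      Tm.wk_subst_liftSubst]
  congr 7
  simp only [subT, Tm.subst, Tm.wk_subst_liftSubst]; rfl

end Substitution

/-! ## Derivability is closed under substitution -/

/-- A set of axioms (in every context) that is closed under substitution. -/
def SubstClosed (T : ∀ V : Ty → Type, Form V → Prop) : Prop :=
  ∀ ⦃V W : Ty → Type⦄ (s : ∀ σ, V σ → Tm W σ) ⦃φ : Form V⦄, T V φ → T W (φ.subst s)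

theorem EPRA.substClosed : SubstClosed EPRA := by
  intro V W s φ h
  have key : ∀ {χ : Form W}, EPRA W χ → χ = φ.subst s → EPRA W (φ.subst s) :=
    fun h e => e ▸ h
  cases h with
  | eq_refl => exact .eq_refl
  | eq_symm => exact .eq_symm
  | eq_trans => exact .eq_trans
  | succ_ne_zero => exact .succ_ne_zero
  | succ_inj => exact .succ_inj
  | ext ρ τ => refine key (.ext ρ τ) ?_; simp only [Form.subst, eqF_subst]; rfl
  | K σ τ => refine key (.K σ τ) ?_; simp only [Form.subst, eqF_subst]; rfl
  | S ρ σ τ => refine key (.S ρ σ τ) ?_; simp only [Form.subst, eqF_subst]; rfl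
  | rec_zero => exact .rec_zero
  | rec_succ => exact .rec_succ
  | qf_ind φ hφ =>
    refine key (.qf_ind (φ.subst (liftSubst s _)) (hφ.subst _)) ?_
    simp only [Form.subst, Form.inst_subst, Form.subst_subst, liftSubst_consSubst, consSubst_comp]
    rfl
  | seq_cases σ =>
    refine key (.seq_cases σ) ?_
    simp only [Form.subst, Form.or, Form.ex, Form.neg, eqF_subst]; rfl
  | len_nil σ => exact .len_nil σ
  | len_cons σ => exact .len_cons σ
  | proj_zero σ => refine key (.proj_zero σ) ?_; simp only [Form.subst, eqF_subst]; rfl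
  | proj_succ σ => refine key (.proj_succ σ) ?_; simp only [Form.subst, eqF_subst]; rfl
  | proj_default σ =>
    refine key (.proj_default σ) ?_
    simp only [Form.subst, Form.neg, eqF_subst, zeroOf_subst]; rfl
  | len_tab σ => exact .len_tab σ
  | proj_tab σ => refine key (.proj_tab σ) ?_; simp only [Form.subst, eqF_subst]; rfl
  | lrec_nil σ => exact .lrec_nil σ
  | lrec_cons σ => exact .lrec_cons σ

theorem Tst.substClosed : SubstClosed Tst := by
  intro V W s φ h
  have key : ∀ {χ : Form W}, Tst W χ → χ = φ.subst s → Tst W (φ.subst s) :=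
    fun h e => e ▸ h
  cases h with
  | congr σ =>
    refine key (.congr σ) ?_
    simp only [Form.subst, Form.and, Form.neg, eqF_subst]; rfl
  | closed t =>
    refine key (.closed t) ?_
    simp only [Form.subst, Tm.subst_subst]
    congr 2; funext _ x; exact x.elim
  | app σ τ => exact .app σ τ

theorem HACint.substClosed : SubstClosed HACint := by
  intro V W s φ h
  have key : ∀ {χ : Form W}, HACint W χ → χ = φ.subst s → HACint W (φ.subst s) :=
    fun h e => e ▸ h
  cases h with
  | mk ρ τ φ hφ =>
    refine key (.mk ρ τ (φ.subst (liftSubst (liftSubst s ρ) τ)) (hφ.subst _)) ?_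
    simp only [Form.subst, Form.allSt, Form.exSt, Form.ex, Form.and, Form.neg, memF_subst,
      Form.subst_subst, liftSubst_consSubst, consSubst_comp]
    congr; funext _ x
    -- In the conclusion of the schema the matrix lies under the binders of `F`, `x` and `y`, so its
    -- parameters are shifted three times.
    change _ = (s _ x).wk.wk.wk
    simp only [Tm.wk, Tm.subst_subst]; rfl

theorem Ideal.substClosed : SubstClosed Ideal := by
  intro V W s φ h
  have key : ∀ {χ : Form W}, Ideal W χ → χ = φ.subst s → Ideal W (φ.subst s) :=
    fun h e => e ▸ h
  cases h with
  | mk σ τ φ hφ =>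
    refine key (.mk σ τ (φ.subst (liftSubst (liftSubst s τ) σ)) (hφ.subst _)) ?_
    simp only [Form.subst, Form.allSt, Form.ex, Form.neg, memF_subst,
      Form.subst_subst, liftSubst_consSubst, consSubst_comp]
    congr; funext _ x
    change _ = (s _ x).wk.wk.wk
    simp only [Tm.wk, Tm.subst_subst]; rfl

theorem QFAC.substClosed : SubstClosed QFAC := by
  intro V W s φ h
  have key : ∀ {χ : Form W}, QFAC W χ → χ = φ.subst s → QFAC W (φ.subst s) :=
    fun h e => e ▸ h
  cases h with
  | mk φ hφ =>
    refine key (.mk (φ.subst (liftSubst (liftSubst s _) _)) (hφ.subst _)) ?_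
    simp only [Form.subst, Form.ex, Form.neg,
      Form.subst_subst, liftSubst_consSubst, consSubst_comp]
    congr; funext _ x
    change _ = (s _ x).wk.wk
    simp only [Tm.wk, Tm.subst_subst]; rfl

theorem RCA0Lambda.substClosed : SubstClosed RCA0Lambda := by
  rintro V W s φ ((h | h | h | h) | h)
  · exact .inl (.inl (EPRA.substClosed s h))
  · exact .inl (.inr (.inl (Tst.substClosed s h)))
  · exact .inl (.inr (.inr (.inl (HACint.substClosed s h))))
  · exact .inl (.inr (.inr (.inr (Ideal.substClosed s h))))
  · exact .inr (QFAC.substClosed s h)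

namespace Prov

variable {T : ∀ V : Ty → Type, Form V → Prop} {V W : Ty → Type}

/-- Used twice: to replace a fresh variable by a bound one in the Henkin construction, and to move
derivations from the context `Vars` back to the empty context. -/
theorem subst (hT : SubstClosed T) {Γ : List (Form V)} {φ : Form V} (h : Prov T V Γ φ) :
    ∀ {W : Ty → Type} (s : ∀ σ, V σ → Tm W σ),
      Prov T W (Γ.map (Form.subst s)) (φ.subst s) := by
  induction h with
  | ax h => exact fun s => .ax (hT s h)
  | hyp h => exact fun s => .hyp (List.mem_map_of_mem h)
  | impI _ ih => exact fun s => .impI (ih s)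
  | impE _ _ ih₁ ih₂ => exact fun s => .impE (ih₁ s) (ih₂ s)
  | raa _ ih => exact fun s => .raa (ih s)
  | @allI V Γ σ φ _ ih =>
    intro W s
    refine .allI ?_
    have e : (Γ.map Form.wk).map (Form.subst (liftSubst s σ)) =
        (Γ.map (Form.subst s)).map Form.wk := by
      simp only [List.map_map]
      congr 1; funext φ; exact Form.wk_subst_liftSubst s φ
    exact e ▸ ih (liftSubst s σ)
  | allE _ t ih =>
    intro W s
    rw [Form.inst_subst]
    exact .allE (ih s) _

theorem weaken {Γ : List (Form V)} {φ : Form V} (h : Prov T V Γ φ) :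
    ∀ {Δ : List (Form V)}, Γ ⊆ Δ → Prov T V Δ φ := by
  induction h with
  | ax h => exact fun _ => .ax h
  | hyp h => exact fun hs => .hyp (hs h)
  | impI _ ih => exact fun hs => .impI (ih (List.cons_subset_cons _ hs))
  | impE _ _ ih₁ ih₂ => exact fun hs => .impE (ih₁ hs) (ih₂ hs)
  | raa _ ih => exact fun hs => .raa (ih (List.cons_subset_cons _ hs))
  | allI _ ih => exact fun hs => .allI (ih (List.map_subset _ hs))
  | allE _ t ih => exact fun hs => .allE (ih hs) t

theorem exfalso {Γ : List (Form V)} (h : Prov T V Γ .bot) (φ : Form V) : Prov T V Γ φ :=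
  .raa (h.weaken (List.subset_cons_self _ _))

theorem cut {Γ : List (Form V)} {φ ψ : Form V} (h₁ : Prov T V Γ φ) (h₂ : Prov T V (φ :: Γ) ψ) :
    Prov T V Γ ψ := .impE (.impI h₂) h₁

end Prov

/-! ## Countability of the language -/

section Countability

/-- An injective numbering of the finite types. -/
def Ty.code : Ty → ℕ
  | .nat => Nat.pair 0 0
  | .arr σ τ => Nat.pair 1 (Nat.pair σ.code τ.code)
  | .seq σ => Nat.pair 2 σ.code

theorem Ty.code_injective : Function.Injective Ty.code := by
  intro σ
  induction σ with
  | nat => intro τ h; cases τ <;> simp [Ty.code] at h ⊢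
  | arr σ τ ih₁ ih₂ =>
    intro τ h; cases τ <;> simp [Ty.code] at h ⊢
    exact ⟨ih₁ h.1, ih₂ h.2⟩
  | seq σ ih =>
    intro τ h; cases τ <;> simp [Ty.code] at h ⊢
    exact ih h

instance : Countable Ty := Ty.code_injective.countable

instance : Countable (Σ σ, Const σ) := by
  let f : ℕ × Ty × Ty × Ty → Σ σ, Const σ
    | (0, _) => ⟨_, .zero⟩
    | (1, _) => ⟨_, .succ⟩
    | (2, σ, τ, _) => ⟨_, .K σ τ⟩
    | (3, ρ, σ, τ) => ⟨_, .S ρ σ τ⟩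
    | (4, _) => ⟨_, .R⟩
    | (5, σ, _) => ⟨_, .nil σ⟩
    | (6, σ, _) => ⟨_, .cons σ⟩
    | (7, σ, _) => ⟨_, .len σ⟩
    | (8, σ, _) => ⟨_, .proj σ⟩
    | (9, σ, _) => ⟨_, .tab σ⟩
    | (_, σ, _) => ⟨_, .L σ⟩
  refine Function.Surjective.countable (f := f) ?_
  rintro ⟨_, c⟩
  cases c with
  | zero => exact ⟨(0, ℕ₀, ℕ₀, ℕ₀), rfl⟩
  | succ => exact ⟨(1, ℕ₀, ℕ₀, ℕ₀), rfl⟩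
  | K σ τ => exact ⟨(2, σ, τ, ℕ₀), rfl⟩
  | S ρ σ τ => exact ⟨(3, ρ, σ, τ), rfl⟩
  | R => exact ⟨(4, ℕ₀, ℕ₀, ℕ₀), rfl⟩
  | nil σ => exact ⟨(5, σ, ℕ₀, ℕ₀), rfl⟩
  | cons σ => exact ⟨(6, σ, ℕ₀, ℕ₀), rfl⟩
  | len σ => exact ⟨(7, σ, ℕ₀, ℕ₀), rfl⟩
  | proj σ => exact ⟨(8, σ, ℕ₀, ℕ₀), rfl⟩
  | tab σ => exact ⟨(9, σ, ℕ₀, ℕ₀), rfl⟩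
  | L σ => exact ⟨(10, σ, ℕ₀, ℕ₀), rfl⟩

variable {V : Ty → Type}

instance [Countable (Σ σ, V σ)] : Countable (Σ σ, Tm V σ) := by
  obtain ⟨v, hv⟩ := exists_injective_nat (Σ σ, V σ)
  obtain ⟨c, hc⟩ := exists_injective_nat (Σ σ, Const σ)
  let code : ∀ {σ : Ty}, Tm V σ → ℕ := fun t => Tm.rec (motive := fun _ _ => ℕ)
    (fun {σ} x => Nat.pair 0 (v ⟨σ, x⟩)) (fun {σ} k => Nat.pair 1 (c ⟨σ, k⟩))
    (fun _ _ a b => Nat.pair 2 (Nat.pair a b)) t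
  have key : ∀ {σ : Ty} (t : Tm V σ) {τ : Ty} (u : Tm V τ), code t = code u →
      (⟨σ, t⟩ : Σ σ, Tm V σ) = ⟨τ, u⟩ := by
    intro σ t
    induction t with
    | var x =>
      intro τ u h
      cases u <;> simp [code] at h
      cases hv h; rfl
    | const k =>
      intro τ u h
      cases u <;> simp [code] at h
      cases hc h; rfl
    | app t u iht ihu =>
      intro τ u h
      cases u <;> simp [code] at h
      cases iht _ h.1; cases ihu _ h.2; rfl
  exact Function.Injective.countable (f := fun p : Σ σ, Tm V σ => code p.2) fun p q h => key _ _ h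

instance [Countable (Σ σ, V σ)] (τ : Ty) : Countable (Tm V τ) :=
  Function.Injective.countable (f := fun t => (⟨τ, t⟩ : Σ σ, Tm V σ)) fun _ _ h => by
    cases h; rfl

instance [Countable (Σ σ, V σ)] (ρ : Ty) : Countable (Σ σ, Ext V ρ σ) := by
  refine Function.Surjective.countable
    (f := fun o : Option (Σ σ, V σ) => o.elim (⟨ρ, .new⟩ : Σ σ, Ext V ρ σ) fun p => ⟨p.1, .old p.2⟩)
    ?_
  rintro ⟨σ, x⟩
  cases x with
  | new => exact ⟨none, rfl⟩
  | old x => exact ⟨some ⟨σ, x⟩, rfl⟩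

/-- The logical depth of a formula. -/
def Form.depth : {V : Ty → Type} → Form V → ℕ
  | _, .eq _ _ => 0
  | _, .st _ => 0
  | _, .bot => 0
  | _, .imp φ ψ => max φ.depth ψ.depth + 1
  | _, .all _ φ => φ.depth + 1

/-- The subformula of a universal formula lives in a larger context, so the induction is on depth,
uniformly in the context. -/
theorem Form.countable_depth_lt (n : ℕ) : ∀ {V : Ty → Type}, Countable (Σ σ, V σ) →
    {φ : Form V | φ.depth < n}.Countable := by
  induction n with
  | zero => intro V _; simp
  | succ n ih =>
    intro V hV
    refine ((((Set.countable_range fun p : Tm V ℕ₀ × Tm V ℕ₀ => Form.eq p.1 p.2).union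
      (Set.countable_range fun p : (Σ σ, Tm V σ) => Form.st p.2)).union
      (Set.countable_singleton Form.bot)).union
      ((ih hV).image2 (ih hV) Form.imp)).union
      (Set.countable_iUnion fun σ => (ih (V := Ext V σ) inferInstance).image (Form.all σ))
      |>.mono ?_
    intro φ h
    cases φ with
    | eq t u => exact .inl (.inl (.inl (.inl ⟨(t, u), rfl⟩)))
    | st t => exact .inl (.inl (.inl (.inr ⟨⟨_, t⟩, rfl⟩)))
    | bot => exact .inl (.inl (.inr rfl))
    | imp φ ψ =>
      simp only [Set.mem_ofPred_eq, Form.depth] at h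
      exact .inl (.inr ⟨φ, by simp only [Set.mem_ofPred_eq]; omega, ψ,
        by simp only [Set.mem_ofPred_eq]; omega, rfl⟩)
    | all σ φ =>
      simp only [Set.mem_ofPred_eq, Form.depth] at h
      exact .inr (Set.mem_iUnion.2 ⟨σ, φ, by simp only [Set.mem_ofPred_eq]; omega, rfl⟩)

instance [hV : Countable (Σ σ, V σ)] : Countable (Form V) := by
  refine Set.countable_univ_iff.1 ((Set.countable_iUnion fun n =>
    Form.countable_depth_lt n hV).mono fun φ _ => Set.mem_iUnion.2 ⟨φ.depth + 1, ?_⟩)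
  simp

end Countability

/-! ## Maximal consistent Henkin theories -/

/-- Countably many variables of each type. -/
abbrev Vars : Ty → Type := fun _ => ℕ

/-- A substitution affects a formula only through finitely many variables. -/
theorem Form.exists_bound {V : Ty → Type} (φ : Form V) : ∀ r : ∀ σ, V σ → ℕ, ∃ N : ℕ,
    ∀ {W : Ty → Type} (s s' : ∀ σ, V σ → Tm W σ), (∀ σ x, r σ x < N → s σ x = s' σ x) →
      φ.subst s = φ.subst s' := by
  have tm : ∀ {V : Ty → Type} {τ : Ty} (t : Tm V τ) (r : ∀ σ, V σ → ℕ), ∃ N : ℕ,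
      ∀ {W : Ty → Type} (s s' : ∀ σ, V σ → Tm W σ), (∀ σ x, r σ x < N → s σ x = s' σ x) →
        t.subst s = t.subst s' := by
    intro V τ t r
    induction t with
    | var x => exact ⟨r _ x + 1, fun s s' h => h _ x (Nat.lt_succ_self _)⟩
    | const c => exact ⟨0, fun _ _ _ => rfl⟩
    | app t u iht ihu =>
      obtain ⟨N, hN⟩ := iht
      obtain ⟨M, hM⟩ := ihu
      refine ⟨max N M, fun s s' h => ?_⟩
      simp only [Tm.subst]
      rw [hN s s' fun σ x hx => h σ x (lt_max_of_lt_left hx),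
        hM s s' fun σ x hx => h σ x (lt_max_of_lt_right hx)]
  induction φ with
  | eq t u =>
    intro r
    obtain ⟨N, hN⟩ := tm t r
    obtain ⟨M, hM⟩ := tm u r
    refine ⟨max N M, fun s s' h => ?_⟩
    simp only [Form.subst]
    rw [hN s s' fun σ x hx => h σ x (lt_max_of_lt_left hx),
      hM s s' fun σ x hx => h σ x (lt_max_of_lt_right hx)]
  | st t =>
    intro r
    obtain ⟨N, hN⟩ := tm t r
    exact ⟨N, fun s s' h => congrArg Form.st (hN s s' h)⟩
  | bot => exact fun _ => ⟨0, fun _ _ _ => rfl⟩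
  | imp φ ψ ih₁ ih₂ =>
    intro r
    obtain ⟨N, hN⟩ := ih₁ r
    obtain ⟨M, hM⟩ := ih₂ r
    refine ⟨max N M, fun s s' h => ?_⟩
    simp only [Form.subst]
    rw [hN s s' fun σ x hx => h σ x (lt_max_of_lt_left hx),
      hM s s' fun σ x hx => h σ x (lt_max_of_lt_right hx)]
  | @all V σ φ ih =>
    intro r
    obtain ⟨N, hN⟩ := ih fun τ x => match x with
      -- The rank of the bound variable is immaterial: lifted substitutions always agree on it.
      | .new => 0
      | .old x => r τ x
    refine ⟨N, fun s s' h => congrArg (Form.all σ) (hN _ _ fun τ x hx => ?_)⟩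
    cases x with
    | new => rfl
    | old x => exact congrArg Tm.wk (h τ x hx)

section Henkin

variable {T : ∀ V : Ty → Type, Form V → Prop}

/-- Generalisation on a fresh variable. Only finitely many variables matter to `Γ` and `ψ`, so a
sufficiently large index `c` is fresh for both. -/
theorem Prov.generalize (hT : SubstClosed T) (Γ : List (Form Vars)) {σ : Ty}
    (ψ : Form (Ext Vars σ)) : ∃ c : ℕ, Prov T Vars Γ (ψ.inst (.var c)) →
      Prov T Vars Γ (.all σ ψ) := by
  classical
  obtain ⟨N, hN⟩ := Form.exists_bound (ψ.all σ) fun _ x => x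
  have hΓ : ∃ M : ℕ, ∀ φ ∈ Γ, ∀ {W : Ty → Type} (s s' : ∀ σ, Vars σ → Tm W σ),
      (∀ σ x, x < M → s σ x = s' σ x) → φ.subst s = φ.subst s' := by
    induction Γ with
    | nil => exact ⟨0, by simp⟩
    | cons φ Γ ih =>
      obtain ⟨M, hM⟩ := ih
      obtain ⟨K, hK⟩ := Form.exists_bound φ fun _ x => x
      refine ⟨max K M, fun χ hχ W s s' h => ?_⟩
      rcases List.mem_cons.1 hχ with rfl | hχ
      · exact hK s s' fun σ x hx => h σ x (lt_max_of_lt_left hx)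
      · exact hM χ hχ s s' fun σ x hx => h σ x (lt_max_of_lt_right hx)
  obtain ⟨M, hM⟩ := hΓ
  refine ⟨max N M, fun h => .allI ?_⟩
  -- This substitution turns the fresh variable into the newly bound one and weakens all others. It
  -- therefore acts on `Γ` as weakening and undoes the instantiation of `ψ`.
  let s : ∀ τ, Vars τ → Tm (Ext Vars σ) τ := fun τ x =>
    if h : σ = τ ∧ x = max N M then h.1 ▸ .var .new else .var (.old x)
  have hs : ∀ τ x, x < max N M → s τ x = .var (.old x) := fun τ x hx => by
    simp [s, hx.ne]
  have e₁ : Γ.map (Form.subst s) = Γ.map Form.wk := List.map_congr_left fun φ hφ =>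
    hM φ hφ _ _ fun τ x hx => hs τ x (lt_max_of_lt_right hx)
  have e₂ : (ψ.inst (.var (max N M))).subst s = ψ := by
    have e := hN s (fun _ x => .var (.old x)) fun τ x hx => hs τ x (lt_max_of_lt_left hx)
    simp only [Form.subst, Form.all.injEq, heq_eq_eq, true_and] at e
    rw [Form.inst_subst, e, Form.subst_liftSubst_inst]
    have e' : (Tm.var (max N M) : Tm Vars σ).subst s = .var .new := by simp [Tm.subst, s]
    rw [e', consSubst_new, Form.subst_var]
  have := h.subst hT s
  rwa [e₁, e₂] at this

/-- One stage of the Lindenbaum construction: a formula is added if that is consistent, and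
otherwise its negation is added, together with a counterexample if it is universal. The
counterexample preserves consistency, since refuting it would prove the universal formula by
`Prov.generalize`. -/
theorem Prov.henkin_step (hT : SubstClosed T) (Γ : List (Form Vars)) (hΓ : ¬ Prov T Vars Γ .bot)
    (φ : Form Vars) : ∃ Δ : List (Form Vars), Γ ⊆ Δ ∧ ¬ Prov T Vars Δ .bot ∧
      (φ ∈ Δ ∨ φ.neg ∈ Δ ∧ ∀ σ ψ, φ = .all σ ψ → ∃ c : ℕ, (ψ.inst (.var c)).neg ∈ Δ) := by
  by_cases h : Prov T Vars (φ :: Γ) .bot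
  · have h' : ¬ Prov T Vars (φ.neg :: Γ) .bot := fun h' => hΓ (.cut (.raa h') h)
    by_cases hφ : ∃ σ ψ, φ = .all σ ψ
    · obtain ⟨σ, ψ, rfl⟩ := hφ
      obtain ⟨c, hc⟩ := Prov.generalize hT ((ψ.all σ).neg :: Γ) ψ
      refine ⟨(ψ.inst (.var c)).neg :: (ψ.all σ).neg :: Γ, ?_, ?_, .inr ⟨by simp, ?_⟩⟩
      · exact fun _ h => by simp [h]
      · exact fun h => h' (.impE (.hyp List.mem_cons_self) (hc (.raa h)))
      · rintro σ' ψ' e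
        cases e
        exact ⟨c, by simp⟩
    · refine ⟨φ.neg :: Γ, List.subset_cons_self _ _, h', .inr ⟨by simp, fun σ ψ e => ?_⟩⟩
      exact (hφ ⟨σ, ψ, e⟩).elim
  · exact ⟨φ :: Γ, List.subset_cons_self _ _, h, .inl (by simp)⟩

/-- A maximal consistent set of formulas with witnesses. -/
structure HenkinTheory (T : ∀ V : Ty → Type, Form V → Prop) where
  mem : Form Vars → Prop
  ax {φ : Form Vars} : T Vars φ → mem φ
  bot : ¬ mem .bot
  imp {φ ψ : Form Vars} : mem (.imp φ ψ) ↔ (mem φ → mem ψ)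
  all {σ : Ty} {φ : Form (Ext Vars σ)} : mem (.all σ φ) ↔ ∀ t, mem (φ.inst t)

theorem exists_henkinTheory (hT : SubstClosed T) (φ₀ : Form Vars)
    (h₀ : ¬ Prov T Vars [φ₀] .bot) : ∃ H : HenkinTheory T, H.mem φ₀ := by
  have : Nonempty (Form Vars) := ⟨.bot⟩
  obtain ⟨enum, henum⟩ := exists_surjective_nat (Form Vars)
  choose next hsub hcons hdec using Prov.henkin_step hT
  let Γ : ℕ → {Γ : List (Form Vars) // ¬ Prov T Vars Γ .bot} := fun n =>
    Nat.rec ⟨[φ₀], h₀⟩ (fun n Δ => ⟨next Δ.1 Δ.2 (enum n), hcons Δ.1 Δ.2 (enum n)⟩) n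
  have mono : ∀ {m n}, m ≤ n → (Γ m).1 ⊆ (Γ n).1 := by
    intro m n hmn
    induction hmn with
    | refl => exact fun _ h => h
    | step _ ih => exact fun _ h => hsub _ (Γ _).2 _ (ih h)
  let S : Form Vars → Prop := fun φ => ∃ n, φ ∈ (Γ n).1
  have dec : ∀ φ, S φ ∨ S φ.neg ∧ ∀ σ ψ, φ = .all σ ψ → ∃ c : ℕ, S (ψ.inst (.var c)).neg := by
    intro φ
    obtain ⟨n, rfl⟩ := henum φ
    rcases hdec _ (Γ n).2 (enum n) with h | ⟨h, h'⟩
    · exact .inl ⟨n + 1, h⟩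
    · refine .inr ⟨⟨n + 1, h⟩, fun σ ψ e => ?_⟩
      obtain ⟨c, hc⟩ := h' σ ψ e
      exact ⟨c, n + 1, hc⟩
  have cons : ∀ φ, S φ → ¬ S φ.neg := by
    rintro φ ⟨n, hn⟩ ⟨m, hm⟩
    refine (Γ (max n m)).2 (.impE (.hyp (mono (le_max_right _ _) hm)) (.hyp ?_))
    exact mono (le_max_left _ _) hn
  have closed : ∀ {n φ}, Prov T Vars (Γ n).1 φ → S φ := by
    intro n φ h
    rcases dec φ with hφ | ⟨⟨m, hm⟩, -⟩
    · exact hφ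
    · refine ((Γ (max n m)).2 (.impE (.hyp (mono (le_max_right _ _) hm)) (h.weaken ?_))).elim
      exact mono (le_max_left _ _)
  refine ⟨⟨S, fun h => closed (n := 0) (.ax h), fun ⟨n, hn⟩ => (Γ n).2 (.hyp hn), ?_, ?_⟩,
    0, List.mem_singleton_self _⟩
  · intro φ ψ
    constructor
    · rintro ⟨n, hn⟩ ⟨m, hm⟩
      exact closed (n := max n m) (.impE (.hyp (mono (le_max_left _ _) hn))
        (.hyp (mono (le_max_right _ _) hm)))
    · intro h
      rcases dec φ with hφ | ⟨⟨m, hm⟩, -⟩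
      · obtain ⟨n, hn⟩ := h hφ
        exact closed (n := n) (.impI (.hyp (List.mem_cons_of_mem _ hn)))
      · exact closed (n := m) (.impI (.exfalso (.impE (.hyp (List.mem_cons_of_mem _ hm))
          (.hyp (by simp))) _))
  · intro σ φ
    constructor
    · rintro ⟨n, hn⟩ t
      exact closed (.allE (.hyp hn) t)
    · intro h
      rcases dec (.all σ φ) with hφ | ⟨-, h'⟩
      · exact hφ
      · obtain ⟨c, hc⟩ := h' σ φ rfl
        exact (cons _ (h _) hc).elim

end Henkin

/-! ## Structures and satisfaction -/

/-- Applicative structures for the language. -/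
structure Str where
  C : Ty → Type
  app {σ τ : Ty} : C (σ ⇒ τ) → C σ → C τ
  con {σ : Ty} : Const σ → C σ
  st {σ : Ty} : C σ → Prop

namespace Str

variable (M : Str) {V W : Ty → Type}

/-- The value of a term under an assignment. -/
def eval (ρ : ∀ σ, V σ → M.C σ) : {τ : Ty} → Tm V τ → M.C τ
  | _, .var x => ρ _ x
  | _, .const c => M.con c
  | _, .app t u => M.app (eval ρ t) (eval ρ u)

variable {M}

/-- Extension of an assignment. -/
def cons {σ : Ty} (a : M.C σ) (ρ : ∀ σ, V σ → M.C σ) : ∀ τ, Ext V σ τ → M.C τ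
  | _, .new => a
  | _, .old x => ρ _ x

variable (M)

/-- Satisfaction of formulas, where equality of type `0` is interpreted as identity. -/
def Sat : {V : Ty → Type} → (∀ σ, V σ → M.C σ) → Form V → Prop
  | _, ρ, .eq t u => M.eval ρ t = M.eval ρ u
  | _, ρ, .st t => M.st (M.eval ρ t)
  | _, _, .bot => False
  | _, ρ, .imp φ ψ => Sat ρ φ → Sat ρ ψ
  | _, ρ, .all σ φ => ∀ a : M.C σ, Sat (M.cons a ρ) φ

variable {M}

theorem eval_subst (ρ : ∀ σ, W σ → M.C σ) (s : ∀ σ, V σ → Tm W σ) {τ : Ty} (t : Tm V τ) :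
    M.eval ρ (t.subst s) = M.eval (fun σ x => M.eval ρ (s σ x)) t := by
  induction t with
  | var x => rfl
  | const c => rfl
  | app t u iht ihu => simp only [Tm.subst, eval, iht, ihu]

@[simp] theorem eval_wk (ρ : ∀ σ, V σ → M.C σ) {σ τ : Ty} (a : M.C σ) (t : Tm V τ) :
    M.eval (M.cons a ρ) t.wk = M.eval ρ t := eval_subst _ _ t

theorem eval_liftSubst (ρ : ∀ σ, W σ → M.C σ) (s : ∀ σ, V σ → Tm W σ) {σ : Ty} (a : M.C σ) :
    (fun τ x => M.eval (M.cons a ρ) (liftSubst s σ τ x)) =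
      M.cons a fun τ x => M.eval ρ (s τ x) := by
  funext τ x
  cases x with
  | new => rfl
  | old x => exact eval_wk ρ a (s τ x)

theorem eval_consSubst (ρ : ∀ σ, W σ → M.C σ) (s : ∀ σ, V σ → Tm W σ) {σ : Ty} (t : Tm W σ) :
    (fun τ x => M.eval ρ (consSubst t s τ x)) =
      M.cons (M.eval ρ t) fun τ x => M.eval ρ (s τ x) := by
  funext τ x; cases x <;> rfl

theorem sat_subst (φ : Form V) : ∀ {W : Ty → Type} (ρ : ∀ σ, W σ → M.C σ)
    (s : ∀ σ, V σ → Tm W σ),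
    M.Sat ρ (φ.subst s) ↔ M.Sat (fun σ x => M.eval ρ (s σ x)) φ := by
  induction φ with
  | eq t u => intros; simp only [Form.subst, Sat, eval_subst]
  | st t => intros; simp only [Form.subst, Sat, eval_subst]
  | bot => intros; rfl
  | imp φ ψ ih₁ ih₂ => intros; simp only [Form.subst, Sat, ih₁, ih₂]
  | all σ φ ih => intros; simp only [Form.subst, Sat, ih, eval_liftSubst]

section Connectives

variable (ρ : ∀ σ, V σ → M.C σ)

theorem sat_eq (t u : Tm V ℕ₀) : M.Sat ρ (.eq t u) ↔ M.eval ρ t = M.eval ρ u := Iff.rfl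
theorem sat_imp (φ ψ : Form V) : M.Sat ρ (.imp φ ψ) ↔ (M.Sat ρ φ → M.Sat ρ ψ) := Iff.rfl
theorem sat_all (σ : Ty) (φ : Form (Ext V σ)) :
    M.Sat ρ (.all σ φ) ↔ ∀ a : M.C σ, M.Sat (M.cons a ρ) φ := Iff.rfl
theorem sat_neg (φ : Form V) : M.Sat ρ φ.neg ↔ ¬ M.Sat ρ φ := Iff.rfl
theorem sat_and (φ ψ : Form V) : M.Sat ρ (φ.and ψ) ↔ M.Sat ρ φ ∧ M.Sat ρ ψ := by
  simp only [Form.and, sat_neg, sat_imp]; tauto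
theorem sat_or (φ ψ : Form V) : M.Sat ρ (φ.or ψ) ↔ M.Sat ρ φ ∨ M.Sat ρ ψ := by
  simp only [Form.or, sat_neg, sat_imp]; tauto
theorem sat_iff (φ ψ : Form V) : M.Sat ρ (φ.iff ψ) ↔ (M.Sat ρ φ ↔ M.Sat ρ ψ) := by
  simp only [Form.iff, sat_and, sat_imp]; tauto
theorem sat_ex (σ : Ty) (φ : Form (Ext V σ)) :
    M.Sat ρ (.ex σ φ) ↔ ∃ a : M.C σ, M.Sat (M.cons a ρ) φ := by
  simp only [Form.ex, sat_neg, sat_all, not_forall, not_not]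
theorem sat_allSt (σ : Ty) (φ : Form (Ext V σ)) :
    M.Sat ρ (.allSt σ φ) ↔ ∀ a : M.C σ, M.st a → M.Sat (M.cons a ρ) φ := Iff.rfl
theorem sat_exSt (σ : Ty) (φ : Form (Ext V σ)) :
    M.Sat ρ (.exSt σ φ) ↔ ∃ a : M.C σ, M.st a ∧ M.Sat (M.cons a ρ) φ := by
  simp only [Form.exSt, sat_ex, sat_and]; rfl

end Connectives

end Str

/-- Models of `RCA₀^Λ` in which the defined equality of every type is identity. -/
structure Model extends Str where
  sound {V : Ty → Type} {φ : Form V} : RCA0Lambda V φ → ∀ ρ : ∀ σ, V σ → C σ, toStr.Sat ρ φ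
  sat_eqF {V : Ty → Type} (ρ : ∀ σ, V σ → C σ) {σ : Ty} (t u : Tm V σ) :
    toStr.Sat ρ (eqF σ t u) ↔ toStr.eval ρ t = toStr.eval ρ u

/-! ## The term model of a Henkin theory -/

namespace HenkinTheory

variable (H : HenkinTheory RCA0Lambda)

theorem epra {φ : Form Vars} (h : EPRA Vars φ) : H.mem φ := H.ax (.inl (.inl h))

theorem mem_all_subst {V : Ty → Type} (s : ∀ σ, V σ → Tm Vars σ) {σ : Ty} (φ : Form (Ext V σ)) :
    H.mem ((Form.all σ φ).subst s) ↔ ∀ t, H.mem (φ.subst (consSubst t s)) := by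
  simp only [Form.subst, H.all, Form.subst_liftSubst_inst]

theorem mem_all₂ {σ τ : Ty} {φ : Form (Ext (Ext Vars σ) τ)} (h : H.mem (.all σ (.all τ φ)))
    (t : Tm Vars σ) (u : Tm Vars τ) :
    H.mem (φ.subst (consSubst u (consSubst t fun _ x => .var x))) :=
  (H.mem_all_subst _ _).1 (H.all.1 h t) u

theorem mem_all₃ {ρ σ τ : Ty} {φ : Form (Ext (Ext (Ext Vars ρ) σ) τ)}
    (h : H.mem (.all ρ (.all σ (.all τ φ)))) (t : Tm Vars ρ) (u : Tm Vars σ) (v : Tm Vars τ) :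
    H.mem (φ.subst (consSubst v (consSubst u (consSubst t fun _ x => .var x)))) :=
  (H.mem_all_subst _ _).1 (H.mem_all₂ h t u) v

theorem mem_neg {φ : Form Vars} : H.mem φ.neg ↔ ¬ H.mem φ := by
  simp only [Form.neg, H.imp, H.bot, imp_false]

theorem mem_and {φ ψ : Form Vars} : H.mem (φ.and ψ) ↔ H.mem φ ∧ H.mem ψ := by
  simp only [Form.and, mem_neg, H.imp]; tauto

theorem mem_eq_symm {t u : Tm Vars ℕ₀} : H.mem (.eq t u) → H.mem (.eq u t) :=
  H.imp.1 (H.mem_all₂ (H.epra .eq_symm) t u)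

theorem mem_eq_trans {t u v : Tm Vars ℕ₀} (h₁ : H.mem (.eq t u)) (h₂ : H.mem (.eq u v)) :
    H.mem (.eq t v) :=
  H.imp.1 (H.imp.1 (H.mem_all₃ (H.epra .eq_trans) t u v) h₁) h₂

theorem mem_ext {ρ τ : Ty} (f : Tm Vars (ρ ⇒ τ)) {t u : Tm Vars ρ} (h : H.mem (eqF ρ t u)) :
    H.mem (eqF τ (f ⬝ t) (f ⬝ u)) := by
  have := H.mem_all₃ (H.epra (.ext ρ τ)) f t u
  simp only [Form.subst, eqF_subst] at this
  exact H.imp.1 this h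

theorem mem_eqF_arr {σ τ : Ty} {t u : Tm Vars (σ ⇒ τ)} :
    H.mem (eqF (σ ⇒ τ) t u) ↔ ∀ a, H.mem (eqF τ (t ⬝ a) (u ⬝ a)) := by
  simp only [eqF, H.all, Form.inst, eqF_subst, Tm.subst, Tm.wk_subst_consSubst, Tm.subst_var]
  rfl

theorem mem_eqF_seq {σ : Ty} {t u : Tm Vars (.seq σ)} :
    H.mem (eqF (.seq σ) t u) ↔ H.mem (.eq (lenT t) (lenT u)) ∧
      ∀ i, H.mem (.eq (subT (succT i) (lenT t)) zeroT) →
        H.mem (eqF σ (projT t i) (projT u i)) := by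
  simp only [eqF, mem_and, H.all, Form.inst, Form.subst, H.imp, eqF_subst, lenT, projT, subT,
    Tm.subst, Tm.wk_subst_consSubst, Tm.subst_var]
  rfl

theorem mem_eqF_refl (σ : Ty) : ∀ t : Tm Vars σ, H.mem (eqF σ t t) := by
  induction σ with
  | nat => exact H.all.1 (H.epra .eq_refl)
  | arr σ τ _ ih => exact fun t => H.mem_eqF_arr.2 fun a => ih _
  | seq σ ih => exact fun t => H.mem_eqF_seq.2 ⟨H.all.1 (H.epra .eq_refl) _, fun i _ => ih _⟩

/-- Equality of sequences compares entries below the length of the left-hand side, so symmetry and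
transitivity require moving this bound between equal lengths. -/
theorem mem_lt_congr (i : Tm Vars ℕ₀) {m n : Tm Vars ℕ₀} (h : H.mem (.eq m n))
    (hi : H.mem (.eq (subT i n) zeroT)) : H.mem (.eq (subT i m) zeroT) :=
  H.mem_eq_trans (H.mem_ext (ρ := ℕ₀) (τ := ℕ₀) (subC ⬝ i) h) hi

theorem mem_eqF_symm (σ : Ty) : ∀ {t u : Tm Vars σ}, H.mem (eqF σ t u) → H.mem (eqF σ u t) := by
  induction σ with
  | nat => exact H.mem_eq_symm
  | arr σ τ _ ih => exact fun h => H.mem_eqF_arr.2 fun a => ih (H.mem_eqF_arr.1 h a)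
  | seq σ ih =>
    intro t u h
    obtain ⟨h₁, h₂⟩ := H.mem_eqF_seq.1 h
    exact H.mem_eqF_seq.2 ⟨H.mem_eq_symm h₁, fun i hi => ih (h₂ i (H.mem_lt_congr _ h₁ hi))⟩

theorem mem_eqF_trans (σ : Ty) : ∀ {t u v : Tm Vars σ}, H.mem (eqF σ t u) →
    H.mem (eqF σ u v) → H.mem (eqF σ t v) := by
  induction σ with
  | nat => exact H.mem_eq_trans
  | arr σ τ _ ih =>
    exact fun h h' => H.mem_eqF_arr.2 fun a => ih (H.mem_eqF_arr.1 h a) (H.mem_eqF_arr.1 h' a)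
  | seq σ ih =>
    intro t u v h h'
    obtain ⟨h₁, h₂⟩ := H.mem_eqF_seq.1 h
    obtain ⟨h₃, h₄⟩ := H.mem_eqF_seq.1 h'
    exact H.mem_eqF_seq.2 ⟨H.mem_eq_trans h₁ h₃, fun i hi =>
      ih (h₂ i hi) (h₄ i (H.mem_lt_congr _ (H.mem_eq_symm h₁) hi))⟩

/-- Equal functions agree at `t` by definition of equality; the axiom of extensionality is needed to
pass from `t` to `u`. -/
theorem mem_eqF_app {σ τ : Ty} {f g : Tm Vars (σ ⇒ τ)} {t u : Tm Vars σ}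
    (h : H.mem (eqF (σ ⇒ τ) f g)) (h' : H.mem (eqF σ t u)) :
    H.mem (eqF τ (f ⬝ t) (g ⬝ u)) :=
  H.mem_eqF_trans τ (H.mem_eqF_arr.1 h t) (H.mem_ext g h')

theorem mem_st_congr {σ : Ty} {t u : Tm Vars σ} (h : H.mem (eqF σ t u)) (ht : H.mem (.st t)) :
    H.mem (.st u) := by
  have := H.mem_all₂ (H.ax (.inl (.inr (.inl (.congr σ))))) t u
  refine H.imp.1 this (H.mem_and.2 ⟨ht, ?_⟩)
  rw [eqF_subst]; exact h

/-- Provable equality of terms. -/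
def setoid (σ : Ty) : Setoid (Tm Vars σ) where
  r t u := H.mem (eqF σ t u)
  iseqv := ⟨H.mem_eqF_refl σ, H.mem_eqF_symm σ, H.mem_eqF_trans σ⟩

/-- Terms modulo provable equality. -/
def termStr : Str where
  C σ := Quotient (H.setoid σ)
  app {σ τ} := Quotient.map₂ (sa := H.setoid (σ ⇒ τ)) (sb := H.setoid σ) (sc := H.setoid τ) Tm.app
    fun _ _ h _ _ h' => H.mem_eqF_app h h'
  con {σ} c := Quotient.mk (H.setoid σ) (.const c)
  st {σ} := Quotient.lift (s := H.setoid σ) (fun t => H.mem (.st t)) fun _ _ h =>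
    propext ⟨H.mem_st_congr h, H.mem_st_congr (H.mem_eqF_symm σ h)⟩

/-- The class of a term. -/
def cls {σ : Ty} (t : Tm Vars σ) : H.termStr.C σ := Quotient.mk (H.setoid σ) t

theorem cls_eq {σ : Ty} {t u : Tm Vars σ} : H.cls t = H.cls u ↔ H.mem (eqF σ t u) :=
  Quotient.eq (r := H.setoid σ)

theorem exists_cls {V : Ty → Type} (ρ : ∀ σ, V σ → H.termStr.C σ) :
    ∃ s : ∀ σ, V σ → Tm Vars σ, ρ = fun σ x => H.cls (s σ x) := by
  refine ⟨fun σ x => Quotient.out (s := H.setoid σ) (ρ σ x), ?_⟩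
  funext σ x
  exact (Quotient.out_eq (s := H.setoid σ) (ρ σ x)).symm

theorem eval_cls {V : Ty → Type} (s : ∀ σ, V σ → Tm Vars σ) {τ : Ty} (t : Tm V τ) :
    H.termStr.eval (fun σ x => H.cls (s σ x)) t = H.cls (t.subst s) := by
  induction t with
  | var x => rfl
  | const c => rfl
  | app t u iht ihu => simp only [Str.eval, iht, ihu]; rfl

theorem cons_cls {V : Ty → Type} (s : ∀ σ, V σ → Tm Vars σ) {σ : Ty} (t : Tm Vars σ) :
    H.termStr.cons (H.cls t) (fun σ x => H.cls (s σ x)) =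
      fun τ x => H.cls (consSubst t s τ x) := by
  funext τ x; cases x <;> rfl

/-- The truth lemma. Every element of the model is the class of a term, so the universal case is the
witness property of the Henkin theory. -/
theorem sat_cls {V : Ty → Type} (φ : Form V) : ∀ s : ∀ σ, V σ → Tm Vars σ,
    H.termStr.Sat (fun σ x => H.cls (s σ x)) φ ↔ H.mem (φ.subst s) := by
  induction φ with
  | eq t u => intro s; simp only [Str.Sat, eval_cls, cls_eq]; rfl
  | st t => intro s; simp only [Str.Sat, eval_cls]; rfl
  | bot => intro s; simp only [Str.Sat, Form.subst, H.bot]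
  | imp φ ψ ih₁ ih₂ => intro s; simp only [Str.Sat, Form.subst, H.imp, ih₁, ih₂]
  | all σ φ ih =>
    intro s
    rw [mem_all_subst]
    constructor
    · intro h t
      exact (ih _).1 (H.cons_cls s t ▸ h (H.cls t))
    · intro h a
      obtain ⟨t, rfl⟩ := Quotient.exists_rep (s := H.setoid σ) a
      exact (H.cons_cls s t).symm ▸ (ih _).2 (h t)

/-- The term model. -/
def termModel : Model where
  toStr := H.termStr
  sound h ρ := by
    obtain ⟨s, rfl⟩ := H.exists_cls ρ
    exact (H.sat_cls _ s).2 (H.ax (RCA0Lambda.substClosed s h))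
  sat_eqF ρ σ t u := by
    obtain ⟨s, rfl⟩ := H.exists_cls ρ
    rw [sat_cls, eqF_subst, eval_cls, eval_cls, cls_eq]

end HenkinTheory

/-- Completeness: a sentence that holds in all models is derivable. -/
theorem RCA0Lambda.completeness (φ : Form NoVar)
    (h : ∀ (M : Model) (ρ : ∀ σ, NoVar σ → M.C σ), M.Sat ρ φ) :
    Prov RCA0Lambda NoVar [] φ := by
  by_contra hφ
  let s : ∀ σ, NoVar σ → Tm Vars σ := fun _ x => x.elim
  obtain ⟨H, hH⟩ := exists_henkinTheory RCA0Lambda.substClosed (φ.subst s).neg fun h' => by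
    refine hφ ?_
    -- Every type has the closed term `zeroOf σ`, which can replace the free variables and so bring
    -- the derivation back to the empty context.
    have := (Prov.raa h').subst RCA0Lambda.substClosed fun σ _ => (zeroOf σ : Tm NoVar σ)
    rw [Form.subst_subst] at this
    have e : φ.subst (fun σ x => (s σ x).subst fun σ _ => (zeroOf σ : Tm NoVar σ)) = φ := by
      conv_rhs => rw [← φ.subst_var]
      congr 1; funext _ x; exact x.elim
    rwa [e] at this
  exact H.mem_neg.1 hH ((H.sat_cls φ s).1 (h H.termModel _))

/-! ## Basic facts about models -/

namespace Str

variable {M : Str} {V : Ty → Type} (ρ : ∀ σ, V σ → M.C σ)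

@[simp] theorem eval_var {σ : Ty} (x : V σ) : M.eval ρ (.var x) = ρ σ x := rfl
@[simp] theorem eval_app {σ τ : Ty} (t : Tm V (σ ⇒ τ)) (u : Tm V σ) :
    M.eval ρ (t ⬝ u) = M.app (M.eval ρ t) (M.eval ρ u) := rfl
@[simp] theorem cons_new {σ : Ty} (a : M.C σ) : M.cons a ρ σ .new = a := rfl
@[simp] theorem cons_old {σ τ : Ty} (a : M.C σ) (x : V τ) : M.cons a ρ τ (.old x) = ρ τ x := rfl

end Str

namespace Model

local infixl:90 " ◃ " => Str.app _

variable {M : Model} {V W : Ty → Type}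

/-- The empty assignment. -/
def nilEnv (M : Model) : ∀ σ, NoVar σ → M.C σ := fun _ x => x.elim

theorem epra {φ : Form V} (h : EPRA V φ) (ρ : ∀ σ, V σ → M.C σ) : M.Sat ρ φ :=
  M.sound (.inl (.inl h)) ρ

theorem app_ext {σ τ : Ty} {f g : M.C (σ ⇒ τ)} (h : ∀ a, f ◃ a = g ◃ a) : f = g :=
  (M.sat_eqF (fun _ x => x) (.var f) (.var g)).1 fun a =>
    (M.sat_eqF (M.cons a fun _ x => x) _ _).2 (h a)

theorem K_app {σ τ : Ty} (a : M.C σ) (b : M.C τ) : M.con (.K σ τ) ◃ a ◃ b = a :=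
  (M.sat_eqF _ _ _).1 (epra (.K σ τ) M.nilEnv a b)

theorem S_app {ρ σ τ : Ty} (f : M.C (ρ ⇒ σ ⇒ τ)) (g : M.C (ρ ⇒ σ)) (a : M.C ρ) :
    M.con (.S ρ σ τ) ◃ f ◃ g ◃ a = f ◃ a ◃ (g ◃ a) :=
  (M.sat_eqF _ _ _).1 (epra (.S ρ σ τ) M.nilEnv f g a)

@[simp] theorem eval_lam {σ τ : Ty} (ρ : ∀ σ, V σ → M.C σ) (t : Tm (Ext V σ) τ) (a : M.C σ) :
    M.eval ρ (lam t) ◃ a = M.eval (M.cons a ρ) t := by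
  induction t with
  | var x =>
    cases x with
    | new => exact (S_app _ _ _).trans (K_app _ _)
    | old x => exact K_app _ _
  | const c => exact K_app _ _
  | app t u iht ihu => exact (S_app _ _ _).trans (by rw [iht, ihu]; rfl)

/-- Abstraction through combinators does not commute with substitution on the nose; extensionality
of the model supplies the equality of values, and this is how closed terms are shown to have the
same value in all contexts. -/
theorem eval_lam_congr {σ τ : Ty} {ρ : ∀ σ, V σ → M.C σ} {ρ' : ∀ σ, W σ → M.C σ}
    {t : Tm (Ext V σ) τ} {t' : Tm (Ext W σ) τ}
    (h : ∀ a, M.eval (M.cons a ρ) t = M.eval (M.cons a ρ') t') :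
    M.eval ρ (lam t) = M.eval ρ' (lam t') :=
  app_ext fun a => by simp only [eval_lam, h]

theorem st_app {σ τ : Ty} {f : M.C (σ ⇒ τ)} {a : M.C σ} (hf : M.st f) (ha : M.st a) :
    M.st (f ◃ a) := by
  have := M.sound (.inl (.inr (.inl (.app σ τ)))) M.nilEnv f a
  rw [Str.sat_imp, Str.sat_and] at this
  exact this ⟨hf, ha⟩

theorem st_eval {ρ : ∀ σ, V σ → M.C σ} (hρ : ∀ σ x, M.st (ρ σ x)) {τ : Ty} (t : Tm V τ) :
    M.st (M.eval ρ t) := by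
  induction t with
  | var x => exact hρ _ x
  | const c => exact M.sound (.inl (.inr (.inl (.closed (.const c))))) M.nilEnv
  | app t u iht ihu => exact st_app iht ihu

/-- The value of a closed term. -/
def val (M : Model) {τ : Ty} (t : Tm NoVar τ) : M.C τ := M.eval M.nilEnv t

theorem st_val {τ : Ty} (t : Tm NoVar τ) : M.st (M.val t) := st_eval (fun _ x => x.elim) t

/-! ## Quantifier-free induction -/

/-- The natural numbers of a model. -/
abbrev N (M : Model) : Type := M.C ℕ₀

def zero : M.N := M.con .zero
def succ (n : M.N) : M.N := M.con .succ ◃ n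
def rec' (n a : M.N) (f : M.C (ℕ₀ ⇒ ℕ₀ ⇒ ℕ₀)) : M.N := M.con .R ◃ n ◃ a ◃ f

/-- Functions of a natural number that are given by a term with parameters. -/
structure Rep {τ : Ty} (F : M.N → M.C τ) : Prop where
  out : ∃ t : Tm (Ext M.C ℕ₀) τ, ∀ n, F n = M.eval (M.cons n fun _ x => x) t

/-- Predicates that are given by a quantifier-free formula with parameters. -/
structure QFD (P : M.N → Prop) : Prop where
  out : ∃ φ : Form (Ext M.C ℕ₀), φ.QF ∧ ∀ n, P n ↔ M.Sat (M.cons n fun _ x => x) φ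

theorem Rep.id : Rep (M := M) (fun n => n) := ⟨x0, fun _ => rfl⟩
theorem Rep.const {τ : Ty} (c : M.C τ) : Rep (M := M) (fun _ => c) :=
  ⟨.var (.old c), fun _ => rfl⟩
theorem Rep.app {σ τ : Ty} {F : M.N → M.C (σ ⇒ τ)} {G : M.N → M.C σ}
    (hF : Rep F) (hG : Rep G) : Rep fun n => F n ◃ G n := by
  obtain ⟨t, ht⟩ := hF.out
  obtain ⟨u, hu⟩ := hG.out
  exact ⟨t ⬝ u, fun n => by simp only [ht, hu, Str.eval_app]⟩

theorem QFD.eq {F G : M.N → M.N} (hF : Rep F) (hG : Rep G) : QFD fun n => F n = G n := by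
  obtain ⟨t, ht⟩ := hF.out
  obtain ⟨u, hu⟩ := hG.out
  exact ⟨.eq t u, trivial, fun n => by simp only [ht, hu, Str.sat_eq]⟩
theorem QFD.imp {P Q : M.N → Prop} (hP : QFD P) (hQ : QFD Q) : QFD fun n => P n → Q n := by
  obtain ⟨φ, hφ, h⟩ := hP.out
  obtain ⟨ψ, hψ, h'⟩ := hQ.out
  exact ⟨.imp φ ψ, ⟨hφ, hψ⟩, fun n => by simp only [h, h', Str.sat_imp]⟩
theorem QFD.not {P : M.N → Prop} (hP : QFD P) : QFD fun n => ¬ P n := by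
  obtain ⟨φ, hφ, h⟩ := hP.out
  exact ⟨φ.neg, ⟨hφ, trivial⟩, fun n => by simp only [h, Str.sat_neg]⟩
theorem QFD.or {P Q : M.N → Prop} (hP : QFD P) (hQ : QFD Q) : QFD fun n => P n ∨ Q n := by
  obtain ⟨φ, hφ, h⟩ := hP.out
  obtain ⟨ψ, hψ, h'⟩ := hQ.out
  exact ⟨φ.or ψ, ⟨⟨hφ, trivial⟩, hψ⟩, fun n => by simp only [h, h', Str.sat_or]⟩
theorem QFD.and {P Q : M.N → Prop} (hP : QFD P) (hQ : QFD Q) : QFD fun n => P n ∧ Q n := by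
  obtain ⟨φ, hφ, h⟩ := hP.out
  obtain ⟨ψ, hψ, h'⟩ := hQ.out
  exact ⟨φ.and ψ, ⟨⟨hφ, hψ, trivial⟩, trivial⟩, fun n => by simp only [h, h', Str.sat_and]⟩

theorem Rep.succ {F : M.N → M.N} (hF : Rep F) : Rep fun n => succ (F n) :=
  Rep.app (.const (M.con .succ)) hF

theorem succ_ne_zero (n : M.N) : succ n ≠ zero := epra .succ_ne_zero M.nilEnv n
theorem succ_inj {m n : M.N} : succ m = succ n → m = n := epra .succ_inj M.nilEnv m n
@[simp] theorem rec_zero (a : M.N) (f : M.C (ℕ₀ ⇒ ℕ₀ ⇒ ℕ₀)) : rec' zero a f = a :=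
  epra .rec_zero M.nilEnv a f
@[simp] theorem rec_succ (n a : M.N) (f : M.C (ℕ₀ ⇒ ℕ₀ ⇒ ℕ₀)) :
    rec' (succ n) a f = f ◃ rec' n a f ◃ n := epra .rec_succ M.nilEnv n a f

section Eval

variable (ρ : ∀ σ, V σ → M.C σ)

@[simp] theorem eval_zeroT : M.eval ρ zeroT = zero := rfl
@[simp] theorem eval_succT (t : Tm V ℕ₀) : M.eval ρ (succT t) = succ (M.eval ρ t) := rfl
@[simp] theorem eval_recT (t u : Tm V ℕ₀) (f : Tm V (ℕ₀ ⇒ ℕ₀ ⇒ ℕ₀)) :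
    M.eval ρ (recT t u f) = rec' (M.eval ρ t) (M.eval ρ u) (M.eval ρ f) := rfl

end Eval

/-! ## The arithmetical operations of a model -/

def add (a b : M.N) : M.N := M.val addC ◃ a ◃ b
def pred (a : M.N) : M.N := M.val predC ◃ a
def sub (a b : M.N) : M.N := M.val subC ◃ a ◃ b
def dist (a b : M.N) : M.N := add (sub a b) (sub b a)
def cond (c a b : M.N) : M.N := M.val condC ◃ c ◃ a ◃ b
def tri (a : M.N) : M.N := M.val triC ◃ a
def pair (a b : M.N) : M.N := M.val pairC ◃ a ◃ b
def root (a : M.N) : M.N := M.val rootC ◃ a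
def snd (a : M.N) : M.N := M.val sndC ◃ a
def fst (a : M.N) : M.N := M.val fstC ◃ a
def get (j l : M.N) : M.N := M.val getC ◃ j ◃ l
def set (j v l : M.N) : M.N := M.val setC ◃ j ◃ v ◃ l

section Eval

variable (ρ : ∀ σ, V σ → M.C σ)

theorem eval_addC : M.eval ρ addC = M.val addC :=
  eval_lam_congr fun _ => eval_lam_congr fun _ =>
    congrArg (rec' _ _) (eval_lam_congr fun _ => eval_lam_congr fun _ => rfl)

@[simp] theorem eval_addT (t u : Tm V ℕ₀) :
    M.eval ρ (addT t u) = add (M.eval ρ t) (M.eval ρ u) := by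
  simp only [addT, Str.eval_app, eval_addC]; rfl

theorem eval_predC : M.eval ρ predC = M.val predC :=
  eval_lam_congr fun _ => congrArg (rec' _ _) (eval_lam_congr fun _ => eval_lam_congr fun _ => rfl)

@[simp] theorem eval_predT (t : Tm V ℕ₀) : M.eval ρ (predT t) = pred (M.eval ρ t) := by
  simp only [predT, Str.eval_app, eval_predC]; rfl

theorem eval_subC : M.eval ρ subC = M.val subC :=
  eval_lam_congr fun _ => eval_lam_congr fun _ =>
    congrArg (rec' _ _) (eval_lam_congr fun _ => eval_lam_congr fun _ => by simp)

@[simp] theorem eval_subT (t u : Tm V ℕ₀) :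
    M.eval ρ (subT t u) = sub (M.eval ρ t) (M.eval ρ u) := by
  simp only [subT, Str.eval_app, eval_subC]; rfl

@[simp] theorem eval_distT (t u : Tm V ℕ₀) :
    M.eval ρ (distT t u) = dist (M.eval ρ t) (M.eval ρ u) := by
  simp only [distT, eval_addT, eval_subT]; rfl

theorem eval_condC : M.eval ρ condC = M.val condC :=
  eval_lam_congr fun _ => eval_lam_congr fun _ => eval_lam_congr fun _ =>
    congrArg (rec' _ _) (eval_lam_congr fun _ => eval_lam_congr fun _ => rfl)

@[simp] theorem eval_condT (t u v : Tm V ℕ₀) :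
    M.eval ρ (condT t u v) = cond (M.eval ρ t) (M.eval ρ u) (M.eval ρ v) := by
  simp only [condT, Str.eval_app, eval_condC]; rfl

theorem eval_triC : M.eval ρ triC = M.val triC :=
  eval_lam_congr fun _ =>
    congrArg (rec' _ _) (eval_lam_congr fun _ => eval_lam_congr fun _ => by simp)

@[simp] theorem eval_triT (t : Tm V ℕ₀) : M.eval ρ (triT t) = tri (M.eval ρ t) := by
  simp only [triT, Str.eval_app, eval_triC]; rfl

theorem eval_pairC : M.eval ρ pairC = M.val pairC :=
  eval_lam_congr fun _ => eval_lam_congr fun _ => by simp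

@[simp] theorem eval_pairT (t u : Tm V ℕ₀) :
    M.eval ρ (pairT t u) = pair (M.eval ρ t) (M.eval ρ u) := by
  simp only [pairT, Str.eval_app, eval_pairC]; rfl

theorem eval_rootC : M.eval ρ rootC = M.val rootC :=
  eval_lam_congr fun _ =>
    congrArg (rec' _ _) (eval_lam_congr fun _ => eval_lam_congr fun _ => by simp)

@[simp] theorem eval_rootT (t : Tm V ℕ₀) : M.eval ρ (rootT t) = root (M.eval ρ t) := by
  simp only [rootT, Str.eval_app, eval_rootC]; rfl

theorem eval_sndC : M.eval ρ sndC = M.val sndC := eval_lam_congr fun _ => by simp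

@[simp] theorem eval_sndT (t : Tm V ℕ₀) : M.eval ρ (sndT t) = snd (M.eval ρ t) := by
  simp only [sndT, Str.eval_app, eval_sndC]; rfl

theorem eval_fstC : M.eval ρ fstC = M.val fstC := eval_lam_congr fun _ => by simp

@[simp] theorem eval_fstT (t : Tm V ℕ₀) : M.eval ρ (fstT t) = fst (M.eval ρ t) := by
  simp only [fstT, Str.eval_app, eval_fstC]; rfl

theorem eval_getC : M.eval ρ getC = M.val getC :=
  eval_lam_congr fun _ => eval_lam_congr fun _ => by
    simp only [eval_fstT, eval_recT]
    exact congrArg (fun f => fst (rec' _ _ f))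
      (eval_lam_congr fun _ => eval_lam_congr fun _ => by simp)

@[simp] theorem eval_getT (t u : Tm V ℕ₀) :
    M.eval ρ (getT t u) = get (M.eval ρ t) (M.eval ρ u) := by
  simp only [getT, Str.eval_app, eval_getC]; rfl

theorem eval_setC : M.eval ρ setC = M.val setC :=
  eval_lam_congr fun _ => eval_lam_congr fun _ => eval_lam_congr fun _ => by
    simp only [eval_succT, eval_addT, eval_recT]
    exact congrArg (rec' _ _) (eval_lam_congr fun _ => eval_lam_congr fun _ => by simp)

@[simp] theorem eval_setT (t u v : Tm V ℕ₀) :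
    M.eval ρ (setT t u v) = set (M.eval ρ t) (M.eval ρ u) (M.eval ρ v) := by
  simp only [setT, Str.eval_app, eval_setC]; rfl

end Eval

/-! ### Represented functions and quantifier-free induction -/

theorem Rep.add {F G : M.N → M.N} (hF : Rep F) (hG : Rep G) :
    Rep fun n => add (F n) (G n) := .app (.app (.const (M.val addC)) hF) hG
theorem Rep.pred {F : M.N → M.N} (hF : Rep F) : Rep fun n => pred (F n) :=
  .app (.const (M.val predC)) hF
theorem Rep.sub {F G : M.N → M.N} (hF : Rep F) (hG : Rep G) :
    Rep fun n => sub (F n) (G n) := .app (.app (.const (M.val subC)) hF) hG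
theorem Rep.tri {F : M.N → M.N} (hF : Rep F) : Rep fun n => tri (F n) :=
  .app (.const (M.val triC)) hF
theorem Rep.root {F : M.N → M.N} (hF : Rep F) : Rep fun n => root (F n) :=
  .app (.const (M.val rootC)) hF
theorem Rep.snd {F : M.N → M.N} (hF : Rep F) : Rep fun n => snd (F n) :=
  .app (.const (M.val sndC)) hF
theorem Rep.fst {F : M.N → M.N} (hF : Rep F) : Rep fun n => fst (F n) :=
  .app (.const (M.val fstC)) hF
theorem Rep.get {F G : M.N → M.N} (hF : Rep F) (hG : Rep G) :
    Rep fun n => get (F n) (G n) := .app (.app (.const (M.val getC)) hF) hG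

/-- The elements of the model serve as variables, so a predicate with parameters is an instance of
the axiom schema. The default tactic builds the quantifier-free definition from the shape of `P`. -/
theorem induction (P : M.N → Prop) (h₀ : P zero) (h₁ : ∀ n, P n → P (succ n)) (n : M.N)
    (hP : QFD P := by
      repeat' (first
        | exact Rep.id | exact Rep.const _ | apply Rep.succ | apply Rep.add
        | apply Rep.pred | apply Rep.sub | apply Rep.tri | apply Rep.root | apply Rep.snd
        | apply Rep.fst | apply Rep.get | apply QFD.eq | apply QFD.or | apply QFD.and
        | apply QFD.not | apply QFD.imp | apply Rep.app)) : P n := by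
  obtain ⟨φ, hφ, h⟩ := hP.out
  have := M.epra (.qf_ind φ hφ) fun _ x => x
  simp only [Str.sat_imp, Str.sat_all, Form.inst, Str.sat_subst, Str.eval_consSubst] at this
  exact (h n).2 (this ((h zero).1 h₀) (fun a ha => (h (succ a)).1 (h₁ a ((h a).2 ha))) n)

/-! ### Addition and subtraction -/

section Arithmetic

variable (a b c : M.N)

@[simp] theorem add_zero : add a zero = a := by simp [add, val, addC]
theorem add_eq_rec : add a b = rec' b a (M.val (lam (lam (succT x1)))) := by
  simp only [add, val, addC, eval_lam]
  exact congrArg (rec' _ _) (eval_lam_congr fun _ => eval_lam_congr fun _ => rfl)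
@[simp] theorem add_succ : add a (succ b) = succ (add a b) := by simp [add_eq_rec, val]
@[simp] theorem pred_zero : pred (zero : M.N) = zero := by simp [pred, val, predC]
@[simp] theorem pred_succ : pred (succ a) = a := by simp [pred, val, predC]
@[simp] theorem sub_zero : sub a zero = a := by simp [sub, val, subC]
theorem sub_eq_rec : sub a b = rec' b a (M.val (lam (lam (predT x1)))) := by
  simp only [sub, val, subC, eval_lam]
  exact congrArg (rec' _ _) (eval_lam_congr fun _ => eval_lam_congr fun _ => by simp)
theorem sub_succ : sub a (succ b) = pred (sub a b) := by simp [sub_eq_rec, val]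
@[simp] theorem cond_zero : cond zero a b = a := by simp [cond, val, condC]
@[simp] theorem cond_succ : cond (succ c) a b = b := by simp [cond, val, condC]

@[simp] theorem zero_add : add zero a = a :=
  induction (fun a => add zero a = a) (by simp) (fun n h => by simp [h]) a
@[simp] theorem succ_add : add (succ a) b = succ (add a b) :=
  induction (fun b => add (succ a) b = succ (add a b)) (by simp) (fun n h => by simp [h]) b
theorem add_comm : add a b = add b a :=
  induction (fun b => add a b = add b a) (by simp) (fun n h => by simp [h]) b
theorem eq_zero_or_succ : a = zero ∨ ∃ b, a = succ b := by
  -- The existential witness is made explicit as `pred a`, which keeps the induction formula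
  -- quantifier-free.
  have := induction (fun a : M.N => a = zero ∨ a = succ (pred a)) (.inl rfl)
    (fun n _ => .inr (by simp)) a
  exact this.imp_right fun h => ⟨_, h⟩
variable {a b c} in
theorem add_left_cancel (h : add a b = add a c) : b = c :=
  (induction (fun a => add a b = add a c → b = c) (by simp)
    (fun n ih h => ih (succ_inj (by simpa using h))) a) h
theorem eq_add_self_succ : a ≠ add a (succ b) := fun h =>
  succ_ne_zero b (add_left_cancel (a := a) (by rw [← h, add_zero]))
variable {a b} in
theorem add_eq_zero (h : add a b = zero) : a = zero ∧ b = zero := by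
  obtain rfl | ⟨b, rfl⟩ := eq_zero_or_succ b
  · exact ⟨by simpa using h, rfl⟩
  · exact (succ_ne_zero _ ((add_succ _ _).symm.trans h)).elim

@[simp] theorem succ_sub_succ : sub (succ a) (succ b) = sub a b :=
  induction (fun b => sub (succ a) (succ b) = sub a b) (by simp [sub_succ])
    (fun n h => by rw [sub_succ, h, sub_succ]) b
@[simp] theorem add_sub_cancel_left : sub (add a b) a = b :=
  induction (fun a => sub (add a b) a = b) (by simp) (fun n h => by simp [h]) a
@[simp] theorem sub_add_self : sub a (add a b) = zero := by
  have : sub a a = zero := induction (fun a : M.N => sub a a = zero) (by simp)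
    (fun n h => by simp [h]) a
  exact induction (fun b => sub a (add a b) = zero) (by simpa using this)
    (fun n h => by rw [add_succ, sub_succ, h, pred_zero]) b
@[simp] theorem sub_self : sub a a = zero := by simpa using sub_add_self a zero

theorem le_or_lt : (∃ k, b = add a k) ∨ ∃ k, a = add b (succ k) := by
  -- Truncated subtraction provides the two witnesses, as an existential formula is not available
  -- for induction.
  have := induction (fun b => b = add a (sub b a) ∨ a = add b (succ (sub a (succ b)))) ?_ ?_ b
  · exact this.imp (fun h => ⟨_, h⟩) fun h => ⟨_, h⟩
  · obtain rfl | ⟨a, rfl⟩ := eq_zero_or_succ a <;> simp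
  · intro b
    rintro (h | h)
    · left
      generalize sub b a = k at h
      subst h
      rw [← add_succ, add_sub_cancel_left]
    · generalize sub a (succ b) = k at h
      obtain rfl | ⟨k, rfl⟩ := eq_zero_or_succ k
      · left; subst h; simp
      · right
        have e : a = add (succ b) (succ k) := by simpa using h
        have : sub a (succ (succ b)) = k := by
          rw [e, add_succ, ← succ_add, add_sub_cancel_left]
        rw [this, ← e]

variable {a b}

theorem sub_eq_zero : sub a b = zero ↔ ∃ k, b = add a k := by
  refine ⟨fun h => ?_, fun ⟨k, h⟩ => by rw [h, sub_add_self]⟩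
  rcases le_or_lt a b with h' | ⟨k, rfl⟩
  · exact h'
  · rw [add_sub_cancel_left] at h
    exact (succ_ne_zero _ h).elim

theorem dist_eq_zero : dist a b = zero ↔ a = b := by
  refine ⟨fun h => ?_, fun h => by simp [dist, h]⟩
  obtain ⟨h₁, h₂⟩ := add_eq_zero h
  obtain ⟨k, rfl⟩ := sub_eq_zero.1 h₁
  rw [add_sub_cancel_left] at h₂
  simp [h₂]

@[simp] theorem dist_self (a : M.N) : dist a a = zero := dist_eq_zero.2 rfl

variable {c} in
theorem cond_of_ne_zero (h : c ≠ zero) (a b : M.N) : cond c a b = b := by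
  obtain rfl | ⟨c, rfl⟩ := eq_zero_or_succ c
  · exact (h rfl).elim
  · exact cond_succ a b c

theorem cond_dist_of_ne (h : a ≠ b) (u v : M.N) : cond (dist a b) u v = v :=
  cond_of_ne_zero (mt dist_eq_zero.1 h) u v

end Arithmetic

/-! ### Pairing -/

section Pairing

@[simp] theorem tri_zero : tri (zero : M.N) = zero := by simp [tri, val, triC]
theorem tri_eq_rec (a : M.N) : tri a = rec' a zero (M.val (lam (lam (succT (addT x1 x0))))) := by
  simp only [tri, val, triC, eval_lam]
  exact congrArg (rec' _ _) (eval_lam_congr fun _ => eval_lam_congr fun _ => by simp)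
@[simp] theorem tri_succ (a : M.N) : tri (succ a) = succ (add (tri a) a) := by
  simp [tri_eq_rec, val]
@[simp] theorem root_zero : root (zero : M.N) = zero := by simp [root, val, rootC]
theorem root_eq_rec (a : M.N) : root a = rec' a zero (M.val (lam (lam
    (condT (distT (succT x0) (triT (succT x1))) (succT x1) x1)))) := by
  simp only [root, val, rootC, eval_lam]
  exact congrArg (rec' _ _) (eval_lam_congr fun _ => eval_lam_congr fun _ => by simp)
theorem root_succ (a : M.N) : root (succ a) =
    cond (dist (succ a) (tri (succ (root a)))) (succ (root a)) (root a) := by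
  simp only [root_eq_rec, rec_succ]
  generalize rec' a zero _ = r
  simp [val]
theorem pair_def (a b : M.N) : pair a b = add (tri (add a b)) b := by
  simp [pair, val, pairC]
theorem snd_def (a : M.N) : snd a = sub a (tri (root a)) := by simp [snd, val, sndC]
theorem fst_def (a : M.N) : fst a = sub (root a) (snd a) := by simp [fst, val, fstC]

/-- The recursion for `root` moves up only on reaching the next triangular number `tri w + w + 1`,
so it is constant from `tri w` to `tri w + w`. -/
theorem root_tri_add (w b : M.N) (h : root (tri w) = w) (hb : sub b w = zero) :
    root (add (tri w) b) = w := by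
  refine (induction (fun b => sub b w = zero → root (add (tri w) b) = w)
    (fun _ => by simpa using h) ?_ b) hb
  intro b ih hb
  obtain ⟨k, hk⟩ := sub_eq_zero.1 hb
  have hw : w = add b (succ k) := by rw [hk]; simp
  rw [add_succ, root_succ, ih (sub_eq_zero.2 ⟨_, hw⟩), cond_dist_of_ne]
  rw [tri_succ]
  intro e
  have := add_left_cancel (succ_inj e)
  exact eq_add_self_succ b k (this.trans hw)

theorem root_tri (w : M.N) : root (tri w) = w := by
  refine induction (fun w : M.N => root (tri w) = w) (by simp) (fun w h => ?_) w
  rw [tri_succ, root_succ, root_tri_add w w h (sub_self w), tri_succ, dist_self, cond_zero]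

theorem root_pair (a b : M.N) : root (pair a b) = add a b := by
  rw [pair_def, root_tri_add _ _ (root_tri _)]
  exact sub_eq_zero.2 ⟨a, add_comm a b⟩

@[simp] theorem snd_pair (a b : M.N) : snd (pair a b) = b := by
  rw [snd_def, root_pair, pair_def, add_sub_cancel_left]
@[simp] theorem fst_pair (a b : M.N) : fst (pair a b) = a := by
  rw [fst_def, root_pair, snd_pair, add_comm, add_sub_cancel_left]

@[simp] theorem fst_zero : fst (zero : M.N) = zero := by
  simp [fst_def, sub_eq_zero]
@[simp] theorem snd_zero : snd (zero : M.N) = zero := by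
  simp [snd_def]

end Pairing

/-! ### Codes of sequences -/

section Codes

/-- The tail of a coded sequence after `j` entries. -/
def drop (j l : M.N) : M.N := rec' j l (M.val (lam (lam (sndT x1))))

theorem get_eq (j l : M.N) : get j l = fst (drop j l) := by
  simp only [get, val, getC, eval_lam, eval_fstT, eval_recT]
  exact congrArg (fun f => fst (rec' _ _ f))
      (eval_lam_congr fun _ => eval_lam_congr fun _ => by simp)
@[simp] theorem drop_zero (l : M.N) : drop zero l = l := rec_zero _ _
@[simp] theorem drop_succ (j l : M.N) : drop (succ j) l = snd (drop j l) := by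
  simp [drop, val]

theorem get_zero (l : M.N) : get zero l = fst l := by simp [get_eq]
theorem get_one (l : M.N) : get (succ zero) l = fst (snd l) := by simp [get_eq]

theorem exists_set (j v l : M.N) : ∃ F : M.N → M.N, set j v l = F (succ (add l j)) ∧
    F zero = zero ∧ ∀ i, F (succ i) =
      pair (cond (dist (sub (add l j) i) j) v (get (sub (add l j) i) l)) (F i) := by
  refine ⟨fun n => rec' n zero (M.eval (M.cons l (M.cons v (M.cons j M.nilEnv))) (lam (lam
    (pairT (condT (distT (subT (addT x2 x4) x0) x4) x3 (getT (subT (addT x2 x4) x0) x2)) x1)))),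
    ?_, rec_zero _ _, ?_⟩
  · simp only [set, val, setC, eval_lam, eval_recT, eval_succT, eval_addT]; rfl
  · intro i; simp

theorem get_zero_set (j v l : M.N) :
    get zero (set j v l) = cond (dist zero j) v (get zero l) := by
  obtain ⟨F, e, -, hF⟩ := exists_set j v l
  rw [e, hF, get_zero, fst_pair, sub_self]

theorem get_one_set (j v l : M.N) (h : j = zero ∨ j = succ zero) :
    get (succ zero) (set j v l) = cond (dist (succ zero) j) v (get (succ zero) l) := by
  obtain ⟨F, e, hF₀, hF⟩ := exists_set j v l
  rw [e, hF, get_one, snd_pair]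
  -- If `l + j = 0`, only one entry has been prepended, so entry 1 is the default `0`; otherwise
  -- entry 1 was prepended just before the last one.
  obtain hk | ⟨k, hk⟩ := eq_zero_or_succ (add l j)
  · obtain ⟨rfl, rfl⟩ := add_eq_zero hk
    rw [hk, hF₀, cond_dist_of_ne (succ_ne_zero _), get_one]; simp
  · rw [hk, hF, fst_pair, hk]
    have : sub (succ k) k = succ zero := by simpa using add_sub_cancel_left k (succ zero)
    rw [this]

end Codes

end Model

namespace Model

local infixl:90 " ◃ " => Str.app _

variable {M : Model} {V W : Ty → Type}

/-! ### Register machines in a model -/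

def instr (e c : M.N) : M.N := get (fst c) e
def reg (i c : M.N) : M.N := get i (snd c)
def write (i v c : M.N) : M.N := pair (succ (fst c)) (set i v (snd c))

/-- One step of a register machine. -/
def step (A : M.C Ty.one) (e c : M.N) : M.N :=
  let o := fst (instr e c)
  let x := snd (instr e c)
  cond o c
    (cond (pred o) (write x zero c)
    (cond (pred (pred o)) (write x (succ (reg x c)) c)
    (cond (pred (pred (pred o))) (write (snd x) (reg (fst x) c) c)
    (cond (pred (pred (pred (pred o)))) (write x (A ◃ reg x c) c)
    (cond (dist (reg (fst x) c) (reg (fst (snd x)) c))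
      (pair (snd (snd x)) (snd c))
      (pair (succ (fst c)) (snd c)))))))

/-- The configuration after a number of steps. -/
def run (A : M.C Ty.one) (e n s : M.N) : M.N :=
  rec' s (pair zero (pair n zero)) (M.val (lam (lam (lam (lam (stepT x3 x2 x1))))) ◃ A ◃ e)

section Eval

variable (ρ : ∀ σ, V σ → M.C σ)

@[simp] theorem eval_instrT (e c : Tm V ℕ₀) :
    M.eval ρ (instrT e c) = instr (M.eval ρ e) (M.eval ρ c) := by
  simp only [instrT, eval_getT, eval_fstT]; rfl

@[simp] theorem eval_regT (e c : Tm V ℕ₀) :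
    M.eval ρ (regT e c) = reg (M.eval ρ e) (M.eval ρ c) := by
  simp only [regT, eval_getT, eval_sndT]; rfl

@[simp] theorem eval_writeT (i v c : Tm V ℕ₀) :
    M.eval ρ (writeT i v c) = write (M.eval ρ i) (M.eval ρ v) (M.eval ρ c) := by
  simp only [writeT, eval_pairT, eval_succT, eval_setT, eval_fstT, eval_sndT]; rfl

@[simp] theorem eval_stepT (A : Tm V Ty.one) (e c : Tm V ℕ₀) :
    M.eval ρ (stepT A e c) = step (M.eval ρ A) (M.eval ρ e) (M.eval ρ c) := by
  simp only [stepT, step, eval_condT, eval_writeT, eval_predT, eval_pairT, eval_succT, eval_regT,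
    eval_fstT, eval_sndT, eval_distT, eval_instrT, eval_zeroT, Str.eval_app]

@[simp] theorem eval_runT (A : Tm V Ty.one) (e n s : Tm V ℕ₀) :
    M.eval ρ (runT A e n s) = run (M.eval ρ A) (M.eval ρ e) (M.eval ρ n) (M.eval ρ s) := by
  simp only [runT, run, eval_recT, eval_pairT, eval_zeroT]
  refine congrArg (rec' _ _) (app_ext fun a => app_ext fun b => ?_)
  simp [val]

end Eval

theorem Rep.run {F : M.N → M.N} (A : M.C Ty.one) (e n : M.N) (hF : Rep F) :
    Rep fun s => run A e n (F s) :=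
  .app (.app (.app (.const (M.con .R)) hF) (.const _)) (.const _)

@[simp] theorem run_zero (A : M.C Ty.one) (e n : M.N) :
    run A e n zero = pair zero (pair n zero) := rec_zero _ _

@[simp] theorem run_succ (A : M.C Ty.one) (e n s : M.N) :
    run A e n (succ s) = step A e (run A e n s) := by
  simp only [run, rec_succ]
  generalize rec' s _ _ = r
  simp [val]

/-- The machine has halted after `s` steps. -/
def Halted (A : M.C Ty.one) (e n s : M.N) : Prop := fst (instr e (run A e n s)) = zero

theorem run_add_of_halted {A : M.C Ty.one} {e n s : M.N} (h : Halted A e n s) (t : M.N) :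
    run A e n (add s t) = run A e n s := by
  refine induction (fun t => run A e n (add s t) = run A e n s) (by simp) (fun t ih => ?_) t
    (.eq (.run _ _ _ (.add (.const _) .id)) (.const _))
  have h' : fst (instr e (run A e n s)) = zero := h
  rw [add_succ, run_succ, ih, step, h', cond_zero]

/-- Both configurations persist until stage `s + t`, which avoids comparing `s` with `t`. -/
theorem run_eq_of_halted {A : M.C Ty.one} {e n s t : M.N} (hs : Halted A e n s)
    (ht : Halted A e n t) : run A e n s = run A e n t := by
  rw [← run_add_of_halted hs t, ← run_add_of_halted ht s, add_comm]

theorem sat_computesF (ρ : ∀ σ, V σ → M.C σ) (A : Tm V Ty.one) (e n m : Tm V ℕ₀) :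
    M.Sat ρ (computesF A e n m) ↔ ∃ s, Halted (M.eval ρ A) (M.eval ρ e) (M.eval ρ n) s ∧
      reg zero (run (M.eval ρ A) (M.eval ρ e) (M.eval ρ n) s) = M.eval ρ m := by
  simp only [computesF, computesInF, Str.sat_ex, Str.sat_and, Str.sat_eq, eval_fstT, eval_instrT,
    eval_runT, Str.eval_wk, eval_zeroT, eval_regT, Str.eval_var, Str.cons_new]
  rfl

/-! ### The search program -/

def one : M.N := succ zero
def two : M.N := succ one
def three : M.N := succ two
def four : M.N := succ three

end Model

/-- The numerals. -/
def numT {V : Ty → Type} : ℕ → Tm V ℕ₀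
  | 0 => zeroT
  | n + 1 => succT (numT n)

/-- The program `R₁ := R₁ + 1; R₀ := R₁; R₀ := A(R₀); if R₀ = R₁ then goto 0`, which searches for
the least positive `n` with `A(n) ≠ n` and outputs `A(n)`. -/
def searchT : Tm NoVar ℕ₀ :=
  pairT (pairT (numT 2) (numT 1))
  (pairT (pairT (numT 3) (pairT (numT 1) (numT 0)))
  (pairT (pairT (numT 4) (numT 0))
  (pairT (pairT (numT 5) (pairT (numT 0) (pairT (numT 1) (numT 0))))
  zeroT)))

namespace Model

local infixl:90 " ◃ " => Str.app _

variable {M : Model} {V W : Ty → Type}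

/-! ### Correctness of the search program -/

theorem step_inc (A : M.C Ty.one) {c : M.N} (h : fst c = zero) :
    step A (M.val searchT) c = write one (succ (reg one c)) c := by
  simp [step, instr, h, get_eq, val, searchT, numT, one]

theorem step_copy (A : M.C Ty.one) {c : M.N} (h : fst c = one) :
    step A (M.val searchT) c = write zero (reg one c) c := by
  simp [step, instr, h, get_eq, val, searchT, numT, one]

theorem step_oracle (A : M.C Ty.one) {c : M.N} (h : fst c = two) :
    step A (M.val searchT) c = write zero (A ◃ reg zero c) c := by
  simp [step, instr, h, get_eq, val, searchT, numT, one, two]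

theorem step_jump (A : M.C Ty.one) {c : M.N} (h : fst c = three) :
    step A (M.val searchT) c = cond (dist (reg zero c) (reg one c)) (pair zero (snd c))
      (pair four (snd c)) := by
  simp [step, instr, h, get_eq, val, searchT, numT, one, two, three, four]

/-- The program has instructions 0 to 3; the next one is read from the trailing code `0`, which
means halt. -/
theorem instr_four {c : M.N} (h : fst c = four) : fst (instr (M.val searchT) c) = zero := by
  simp [instr, h, get_eq, val, searchT, numT, one, two, three, four]

@[simp] theorem fst_write (i v c : M.N) : fst (write i v c) = succ (fst c) := by simp [write]
@[simp] theorem reg_zero_write_zero (v c : M.N) : reg zero (write zero v c) = v := by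
  simp [write, reg, get_zero_set]
@[simp] theorem reg_one_write_zero (v c : M.N) : reg one (write zero v c) = reg one c := by
  simp [write, reg, one, get_one_set, cond_dist_of_ne (succ_ne_zero _)]
@[simp] theorem reg_one_write_one (v c : M.N) : reg one (write one v c) = v := by
  simp [write, reg, one, get_one_set]

/-- One round of the search. -/
theorem round_step (A : M.C Ty.one) {c n : M.N} (h : fst c = zero) (hn : reg one c = n) :
    ∃ c', step A (M.val searchT) (step A (M.val searchT) (step A (M.val searchT) c)) = c' ∧
      fst c' = three ∧ reg one c' = succ n ∧ reg zero c' = A ◃ succ n := by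
  rw [step_inc A h, step_copy A (c := write one _ c) (by simp [h, one]),
    step_oracle A (c := write zero _ _) (by simp [h, one, two])]
  exact ⟨_, rfl, by simp [h, one, two, three], by simp [hn], by simp [hn]⟩

/-- A round starting with `n` in register 1 tests `A(n + 1)`. A value different from `n + 1` would
have to be `k`, and the machine would halt with output `k`, contrary to `h`. So every round returns
to instruction 0, and every positive number is eventually tested. -/
theorem search (A : M.C Ty.one) (k : M.N) (hA : ∀ n, A ◃ n = n ∨ A ◃ n = k)
    (h : ∀ s, Halted A (M.val searchT) (M.val searchT) s →
      reg zero (run A (M.val searchT) (M.val searchT) s) ≠ k) (n : M.N) :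
    A ◃ succ n = succ n := by
  have key : ∀ c n s, run A (M.val searchT) (M.val searchT) s = c → fst c = zero →
      reg one c = n → ∃ c', run A (M.val searchT) (M.val searchT)
        (succ (succ (succ (succ s)))) = c' ∧
        fst c' = zero ∧ reg one c' = succ n ∧ A ◃ succ n = succ n := by
    intro c n s hc h₀ h₁
    obtain ⟨c', e, h₂, h₃, h₄⟩ := round_step A h₀ h₁
    have hrun : run A (M.val searchT) (M.val searchT) (succ (succ (succ (succ s)))) =
        cond (dist (A ◃ succ n) (succ n)) (pair zero (snd c')) (pair four (snd c')) := by
      rw [run_succ, run_succ, run_succ, run_succ, hc, e, step_jump A h₂, h₃, h₄]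
    rcases hA (succ n) with hn | hn
    · rw [hn, dist_self, cond_zero] at hrun
      exact ⟨_, hrun, by simp, by simpa [reg] using h₃, hn⟩
    · by_cases hn' : A ◃ succ n = succ n
      · rw [hn', dist_self, cond_zero] at hrun
        exact ⟨_, hrun, by simp, by simpa [reg] using h₃, hn'⟩
      · rw [cond_dist_of_ne hn'] at hrun
        refine (h (succ (succ (succ (succ s)))) ?_ ?_).elim
        · rw [Halted, hrun]
          exact instr_four (by simp)
        · rw [hrun, ← hn, ← h₄]
          simp [reg]
  -- A round takes four steps, so round `n` begins at stage `4n`, written as a sum. Naming the stage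
  -- explicitly makes the invariant quantifier-free.
  have inv : ∀ n, fst (run A (M.val searchT) (M.val searchT) (add (add n n) (add n n))) = zero ∧
      reg one (run A (M.val searchT) (M.val searchT) (add (add n n) (add n n))) = n := by
    intro n
    refine induction (fun n =>
      fst (run A (M.val searchT) (M.val searchT) (add (add n n) (add n n))) = zero ∧
      reg one (run A (M.val searchT) (M.val searchT) (add (add n n) (add n n))) = n)
      ?_ (fun n ih => ?_) n ?_
    · simp [reg, get_one, one]
    · obtain ⟨c', e, h₀, h₁, -⟩ := key _ n _ rfl ih.1 ih.2
      simp only [add_succ, succ_add, e, h₀, h₁, true_and]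
    · have : Rep (M := M) fun n => run A (M.val searchT) (M.val searchT)
          (add (add n n) (add n n)) :=
        .run _ _ _ (.add (.add .id .id) (.add .id .id))
      exact .and (.eq (.fst this) (.const _)) (.eq (.get (.const _) (.snd this)) .id)
  obtain ⟨_, -, -, -, hn⟩ := key _ n _ rfl (inv n).1 (inv n).2
  exact hn

/-! ## The two principles in a model -/

/-- The semantic content of `Π⁰₁-TRANS`. -/
def Transfer (M : Model) : Prop :=
  ∀ f : M.C Ty.one, M.st f → (∀ n, M.st n → f ◃ n = zero) → ∀ m, f ◃ m = zero

/-- The semantic content of the matrix of `UDNR⁺`. -/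
structure IsUDNR (Ψ : M.C (Ty.one ⇒ Ty.one)) : Prop where
  st : M.st Ψ
  dnr : ∀ A, M.st A → ∀ e, ¬ ∃ s, Halted A e e s ∧ reg zero (run A e e s) = Ψ ◃ A ◃ e
  congr : ∀ C, M.st C → ∀ D, M.st D → (∀ n, M.st n → C ◃ n = D ◃ n) →
    ∀ n, M.st n → Ψ ◃ C ◃ n = Ψ ◃ D ◃ n

theorem sat_Pi01TRANS (ρ : ∀ σ, NoVar σ → M.C σ) : M.Sat ρ Pi01TRANS ↔ M.Transfer := Iff.rfl

theorem sat_UDNRplus (ρ : ∀ σ, NoVar σ → M.C σ) :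
    M.Sat ρ UDNRplus ↔ ∃ Ψ : M.C (Ty.one ⇒ Ty.one), IsUDNR Ψ := by
  simp only [UDNRplus, Str.sat_exSt, Str.sat_and, Str.sat_allSt, Str.sat_all, Str.sat_neg,
    sat_computesF, Str.sat_imp, approx1, Str.sat_eq, Str.eval_app, Str.eval_wk, Str.eval_var,
    Str.cons_new, Str.cons_old]
  exact ⟨fun ⟨Ψ, h₁, h₂, h₃⟩ => ⟨Ψ, h₁, h₂, h₃⟩, fun ⟨Ψ, h⟩ => ⟨Ψ, h.1, h.2, h.3⟩⟩

/-! ### From `UDNR⁺` to transfer -/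

theorem st_zero : M.st (zero : M.N) := M.st_val zeroT

theorem IsUDNR.transfer {Ψ : M.C (Ty.one ⇒ Ty.one)} (h : IsUDNR Ψ) : M.Transfer := by
  intro f hf hf₀ m
  let I : M.C Ty.one := M.val (lam x0)
  have hI : ∀ n, I ◃ n = n := fun n => eval_lam _ _ _
  -- The value at the identity is fixed in advance, so that `D` can be defined from it without
  -- circularity.
  let k := Ψ ◃ I ◃ M.val searchT
  have hk : M.st k := st_app (st_app h.st (M.st_val _)) (M.st_val _)
  let D : M.C Ty.one := M.val (lam (lam (lam (condT (x2 ⬝ x0) x0 x1)))) ◃ f ◃ k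
  have hD : ∀ n, D ◃ n = cond (f ◃ n) n k := fun n => by simp [D, val]
  have hDst : M.st D := st_app (st_app (M.st_val _) hf) hk
  have hDk : Ψ ◃ D ◃ M.val searchT = k := by
    refine (h.congr I (M.st_val _) D hDst (fun n hn => ?_) _ (M.st_val _)).symm
    rw [hI, hD, hf₀ n hn, cond_zero]
  have hsearch := search D k (fun n => by
    rw [hD]
    by_cases h₀ : f ◃ n = zero
    · left; rw [h₀, cond_zero]
    · right; rw [cond_of_ne_zero h₀]) fun s hs hs' =>
      h.dnr D hDst (M.val searchT) ⟨s, hs, hs'.trans hDk.symm⟩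
  by_contra hm
  obtain rfl | ⟨m, rfl⟩ := eq_zero_or_succ m
  · exact hm (hf₀ _ st_zero)
  -- A positive number at which `f` is nonzero equals `k` and is therefore standard, contradicting
  -- `hf₀`.
  · have := hsearch m
    rw [hD, cond_of_ne_zero hm] at this
    exact hm (this ▸ hf₀ k hk)

/-! ### From transfer to `UDNR⁺` -/

/-- `HAC_int` for the formula `(∀ m)(f(m) ≠ 0 → f(n) ≠ 0)`. -/
theorem Transfer.exists_finite_search (h : M.Transfer) :
    ∃ F : M.C (Ty.one ⇒ .seq ℕ₀), M.st F ∧ ∀ f, M.st f → ∃ i,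
      sub (succ i) (M.con (.len ℕ₀) ◃ (F ◃ f)) = zero ∧
      ∀ m, f ◃ m ≠ zero → f ◃ (M.con (.proj ℕ₀) ◃ (F ◃ f) ◃ i) ≠ zero := by
  have hac := M.sound (.inl (.inr (.inr (.inl (.mk Ty.one ℕ₀
    (.all ℕ₀ (.imp (.neg (.eq (x2 ⬝ x0) zeroT)) (.neg (.eq (x2 ⬝ x1) zeroT))))
    (by simp [Form.Internal, Form.neg])))))) M.nilEnv
  simp only [Str.sat_imp, Str.sat_allSt, Str.sat_exSt, Str.sat_all, Str.sat_neg, Str.sat_eq,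
    Str.eval_app, Str.eval_var, Str.cons_new, Str.cons_old, eval_zeroT, Str.sat_ex, Str.sat_and,
    memF, ltF, eval_subT, eval_succT, lenT, projT, Str.eval_wk, Str.sat_subst,
    Str.eval_consSubst, M.sat_eqF] at hac
  obtain ⟨F, hF, hF'⟩ := hac fun f hf => by
    -- If `f` vanishes on the standard numbers, transfer makes it vanish everywhere and any standard
    -- number is a witness; otherwise a standard nonzero place is one.
    by_cases h₀ : ∀ n, M.st n → f ◃ n = zero
    · exact ⟨zero, st_zero, fun m hm => (hm (h f hf h₀ m)).elim⟩
    · push Not at h₀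
      obtain ⟨n, hn, hn'⟩ := h₀
      exact ⟨n, hn, fun _ _ => hn'⟩
  refine ⟨F, hF, fun f hf => ?_⟩
  obtain ⟨n, ⟨i, hi, e⟩, hn⟩ := hF' f hf
  exact ⟨i, hi, fun m hm => e ▸ hn m hm⟩

/-- The last entry `n` of `x` with `f(n) ≠ 0`. -/
def lookupT (V : Ty → Type) : Tm V (Ty.one ⇒ .seq ℕ₀ ⇒ ℕ₀) :=
  lam (lam (recT (lenT x0) zeroT
    (lam (lam (condT (x3 ⬝ projT x2 x0) x1 (projT x2 x0))))))

/-- Once the recursion has passed the good index `i`, its value stays good: an entry replaces the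
current value only if `f` is nonzero there. -/
theorem lookup_ne_zero (f : M.C Ty.one) (x : M.C (.seq ℕ₀)) (i : M.N)
    (hi : sub (succ i) (M.con (.len ℕ₀) ◃ x) = zero)
    (hf : f ◃ (M.con (.proj ℕ₀) ◃ x ◃ i) ≠ zero) :
    f ◃ (M.val (lookupT NoVar) ◃ f ◃ x) ≠ zero := by
  simp only [val, lookupT, eval_lam, eval_recT, lenT, Str.eval_app, Str.eval_var, Str.cons_new,
    eval_zeroT]
  generalize hg : M.eval (M.cons x (M.cons f M.nilEnv)) (lam (lam _)) = g
  have hg' : ∀ a b, g ◃ a ◃ b =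
      cond (f ◃ (M.con (.proj ℕ₀) ◃ x ◃ b)) a (M.con (.proj ℕ₀) ◃ x ◃ b) := by
    intro a b; rw [← hg]; simp [projT]; rfl
  refine (induction (fun k => sub (succ i) k = zero → f ◃ rec' k zero g ≠ zero)
    (fun h => ?_) (fun k ih h => ?_) _ ?_) hi
  · rw [sub_zero] at h
    exact (succ_ne_zero _ h).elim
  · rw [rec_succ, hg']
    by_cases hk : f ◃ (M.con (.proj ℕ₀) ◃ x ◃ k) = zero
    · rw [hk, cond_zero]
      refine ih ?_
      obtain ⟨j, hj⟩ := sub_eq_zero.1 h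
      -- Here `k = i + j`. The case `j = 0` is impossible because `f` vanishes at entry `k` but not
      -- at entry `i`.
      obtain rfl | ⟨j, rfl⟩ := eq_zero_or_succ j
      · rw [add_zero] at hj
        exact (hf (succ_inj hj ▸ hk)).elim
      · refine sub_eq_zero.2 ⟨j, succ_inj ?_⟩
        rw [hj, add_succ]
    · rwa [cond_of_ne_zero hk]
  · exact .imp (.eq (.sub (.const _) .id) (.const _)) (.not (.eq (.app (.const _)
      (.app (.app (.app (.const (M.con .R)) .id) (.const _)) (.const _))) (.const _)))

/-- The function that is `1` at the stages at which `Φ_e^A(e)` has halted, and `0` elsewhere. -/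
def haltT (V : Ty → Type) : Tm V (Ty.one ⇒ ℕ₀ ⇒ Ty.one) :=
  lam (lam (lam (condT (fstT (instrT x1 (runT x2 x1 x1 x0))) (succT zeroT) zeroT)))

theorem eval_haltT (ρ : ∀ σ, V σ → M.C σ) (A : M.C Ty.one) (e s : M.N) :
    M.eval ρ (haltT V) ◃ A ◃ e ◃ s =
      cond (fst (instr e (run A e e s))) (succ zero) zero := by
  simp [haltT]

theorem eval_haltT_eq (ρ : ∀ σ, V σ → M.C σ) : M.eval ρ (haltT V) = M.val (haltT NoVar) :=
  app_ext fun A => app_ext fun e => app_ext fun s => by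
    rw [eval_haltT, val, eval_haltT]

theorem haltT_ne_zero {A : M.C Ty.one} {e s : M.N} :
    M.val (haltT NoVar) ◃ A ◃ e ◃ s ≠ zero ↔ Halted A e e s := by
  rw [val, eval_haltT, Halted]
  constructor
  · intro h
    by_contra h'
    exact h (cond_of_ne_zero h' _ _)
  · intro h
    rw [h, cond_zero]
    exact succ_ne_zero _

theorem eval_lookupT_eq (ρ : ∀ σ, V σ → M.C σ) :
    M.eval ρ (lookupT V) = M.val (lookupT NoVar) :=
  eval_lam_congr fun _ => eval_lam_congr fun _ =>
    congrArg (rec' _ _) (eval_lam_congr fun _ => eval_lam_congr fun _ => by simp [projT]; rfl)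

/-- A stage at which the computation `Φ_e^A(e)` has halted if it halts at all, provided that `F`
is a finite search functional. -/
def stageT (V : Ty → Type) : Tm V ((Ty.one ⇒ .seq ℕ₀) ⇒ Ty.one ⇒ ℕ₀ ⇒ ℕ₀) :=
  lam (lam (lam (lookupT _ ⬝ (haltT _ ⬝ x1 ⬝ x0) ⬝ (x2 ⬝ (haltT _ ⬝ x1 ⬝ x0)))))

theorem eval_stageT (ρ : ∀ σ, V σ → M.C σ) (F : M.C (Ty.one ⇒ .seq ℕ₀)) (A : M.C Ty.one)
    (e : M.N) : M.eval ρ (stageT V) ◃ F ◃ A ◃ e =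
      M.val (lookupT NoVar) ◃ (M.val (haltT NoVar) ◃ A ◃ e) ◃
        (F ◃ (M.val (haltT NoVar) ◃ A ◃ e)) := by
  simp [stageT, eval_haltT_eq, eval_lookupT_eq]

theorem eval_stageT_eq (ρ : ∀ σ, V σ → M.C σ) : M.eval ρ (stageT V) = M.val (stageT NoVar) :=
  app_ext fun F => app_ext fun A => app_ext fun e => by
    rw [eval_stageT]; exact (eval_stageT _ F A e).symm

/-- The finite search only applies to standard functions, hence to the halting function for standard
`e`. Transfer then covers nonstandard `e` and `s`, since "halted at `s` implies halted at `g(A, e)`"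
is decided by a standard function of the pair `(e, s)`. -/
theorem Transfer.exists_stage (h : M.Transfer) : ∃ g : M.C (Ty.one ⇒ ℕ₀ ⇒ ℕ₀), M.st g ∧
    ∀ A, M.st A → ∀ e s, Halted A e e s → Halted A e e (g ◃ A ◃ e) := by
  obtain ⟨F, hF, hF'⟩ := h.exists_finite_search
  refine ⟨M.val (stageT NoVar) ◃ F, st_app (M.st_val _) hF, fun A hA e s => ?_⟩
  let q : M.C Ty.one := M.eval M.nilEnv (lam (lam (lam
    (condT (haltT _ ⬝ x1 ⬝ fstT x0 ⬝ sndT x0) zeroT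
      (condT (haltT _ ⬝ x1 ⬝ fstT x0 ⬝ (stageT _ ⬝ x2 ⬝ x1 ⬝ fstT x0)) (succT zeroT) zeroT))))) ◃
    F ◃ A
  have hq : ∀ p, q ◃ p = zero ↔ (Halted A (fst p) (fst p) (snd p) →
      Halted A (fst p) (fst p) (M.val (stageT NoVar) ◃ F ◃ A ◃ fst p)) := by
    intro p
    rw [← haltT_ne_zero, ← haltT_ne_zero]
    simp only [q, eval_lam, eval_condT, Str.eval_app, eval_haltT_eq, eval_stageT_eq,
      eval_fstT, eval_sndT, Str.eval_var, Str.cons_new, Str.cons_old, eval_succT, eval_zeroT]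
    by_cases h₁ : M.val (haltT NoVar) ◃ A ◃ fst p ◃ snd p = zero
    · simp [h₁]
    · rw [cond_of_ne_zero h₁]
      by_cases h₂ : M.val (haltT NoVar) ◃ A ◃ fst p ◃ (M.val (stageT NoVar) ◃ F ◃ A ◃ fst p) = zero
      · simp [h₁, h₂, succ_ne_zero]
      · simp [cond_of_ne_zero h₂, h₂]
  have := (hq (pair e s)).1 (h q (st_app (st_app (M.st_val _) hF) hA) (fun p hp => ?_) _)
  · simpa using this
  · rw [hq, ← haltT_ne_zero, ← haltT_ne_zero,
      show M.val (stageT NoVar) ◃ F ◃ A ◃ fst p = _ from eval_stageT _ F A (fst p)]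
    have hp' : M.st (fst p) := st_app (M.st_val _) hp
    obtain ⟨i, hi, hn⟩ := hF' (M.val (haltT NoVar) ◃ A ◃ fst p)
      (st_app (st_app (M.st_val _) hA) hp')
    exact fun hs => lookup_ne_zero _ _ i hi (hn _ hs)

theorem Transfer.exists_isUDNR (h : M.Transfer) : ∃ Ψ : M.C (Ty.one ⇒ Ty.one), IsUDNR Ψ := by
  obtain ⟨g, hg, hg'⟩ := h.exists_stage
  -- The successor makes the value differ from the output of a halting computation; if stage `g(A,
  -- e)` has not halted, no stage has, and `0` is harmless.
  let Ψ : M.C (Ty.one ⇒ Ty.one) := M.val (lam (lam (lam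
    (condT (fstT (instrT x0 (runT x1 x0 x0 (x2 ⬝ x1 ⬝ x0))))
      (succT (regT zeroT (runT x1 x0 x0 (x2 ⬝ x1 ⬝ x0)))) zeroT)))) ◃ g
  have hΨ : ∀ A e, Ψ ◃ A ◃ e = cond (fst (instr e (run A e e (g ◃ A ◃ e))))
      (succ (reg zero (run A e e (g ◃ A ◃ e)))) zero := fun A e => by simp [Ψ, val]
  refine ⟨Ψ, st_app (M.st_val _) hg, ?_, ?_⟩
  · rintro A hA e ⟨s, hs, hs'⟩
    have ht := hg' A hA e s hs
    have e' : fst (instr e (run A e e (g ◃ A ◃ e))) = zero := ht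
    rw [hΨ, e', cond_zero, run_eq_of_halted hs ht] at hs'
    refine eq_add_self_succ _ zero (hs'.trans ?_)
    simp
  · intro C hC D hD hCD
    -- Transfer applied to the distance of `C` and `D` makes them agree at all numbers, so they are
    -- equal by extensionality.
    have : C = D := app_ext fun n => by
      let d : M.C Ty.one := M.val (lam (lam (lam (distT (x2 ⬝ x0) (x1 ⬝ x0))))) ◃ C ◃ D
      have hd : ∀ n, d ◃ n = dist (C ◃ n) (D ◃ n) := fun n => by simp [d, val]
      refine dist_eq_zero.1 ((hd n).symm.trans (h d (st_app (st_app (M.st_val _) hC) hD) ?_ n))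
      intro n hn
      rw [hd, hCD n hn, dist_self]
    exact fun n _ => by rw [this]

end Model

end NSRM

theorem mainTheorem2 :
    NSRM.Prov NSRM.RCA0Lambda NSRM.NoVar []
      (NSRM.Form.iff NSRM.UDNRplus NSRM.Pi01TRANS) := by
  refine NSRM.RCA0Lambda.completeness _ fun M ρ => ?_
  rw [NSRM.Str.sat_iff, NSRM.Model.sat_UDNRplus, NSRM.Model.sat_Pi01TRANS]
  exact ⟨fun ⟨_, h⟩ => h.transfer, fun h => h.exists_isUDNR⟩
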